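/- Let $d\in\{2,3\}$, let $\Omega\subset\mathbb R^d$ be a bounded polygonal/polyhedral domain, and let $\delta_0>0$ and $R$ be real numbers. Write $(\cdot,\cdot)$, $\|\cdot\|$ for the $L^2(\Omega)$ inner product and norm. Consider any $\nu>0$, $\gamma\ge 0$ with $\nu\le R$, $\gamma\le R$; any smooth divergence-free $\mathbf a:\Omega\to\mathbb R^d$ with $\|\mathbf a\|_{L^\infty(\Omega)}=1$; any symmetric positive semi-definite bilinear form $s$ on $L^2(\Omega)$; any conforming tessellation $\mathcal T_h$ of $\Omega$ into finitely many elements (triangles/tetrahedra or quadrilaterals/hexahedra) and any polynomial degree $k_0\ge 0$, with the equal-order spaces $$\mathbf V_h=\{\mathbf v\in H^1_0(\Omega)^d:\ \mathbf v|_T\in R_{k_0}(T)^d\ \forall T\in\mathcal T_h\},\qquad Q_h=\{q\in L^2(\Omega):\ \textstyle\int_\Omega q=0,\ q|_T\in R_{k_0}(T)\ \forall T\in\mathcal T_h\},$$ where $R_{k_0}(T)$ consists of the polynomials of total degree at most $k_0$ if $T$ is a simplex, and of the (mapped) tensor product polynomials of degree at most $k_0$ in each variable if $T$ is a quadrilateral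 or hexahedron. Assume the inf-sup condition $$\sup_{0\ne\mathbf v\in\mathbf V_h}\frac{-(p,\operatorname{div}\mathbf v)}{\|\nabla\mathbf v\|}+s(p,p)^{1/2}\ \ge\ \delta_0\|p\|\qquad\forall p\in Q_h$$ (the supremum is read as $0$ if $\mathbf V_h=\{0\}$). For bases $\{\psi_i\}_{i=1}^n$ of $\mathbf V_h$ and $\{\phi_i\}_{i=1}^m$ of $Q_h$ define the matrices $$A_\gamma=\nu D+N+\gamma G,\quad D_{ij}=(\nabla\psi_i,\nabla\psi_j),\quad N_{ij}=(\mathbf a\cdot\nabla\psi_j,\psi_i),\quad G_{ij}=(\operatorname{div}\psi_i,\operatorname{div}\psi_j),$$ $$B_{ij}=-(\phi_i,\operatorname{div}\psi_j),\quad C_{ij}=(\nu+\gamma)^{-1}s(\phi_i,\phi_j),\quad M_{ij}=(\phi_i,\phi_j),\quad A_s=\tfrac12(A_\gamma+A_\gamma^T),$$ $$S=BA_\gamma^{-1}B^T+C,\quad \widehat S=(\nu+\gamma)^{-1}M+C,$$ $$\mathcal K=\begin{pmatrix}A_\gamma&B^T\\B&-C\end{pmatrix},\quad \widehat{\mathcal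 P}=\begin{pmatrix}A_\gamma&B^T\\0&-\widehat S\end{pmatrix},\quad \mathcal M=\begin{pmatrix}A_s&0\\0&\widehat S\end{pmatrix},$$ and put $\langle x,y\rangle_{\mathcal M^{-1}}=\langle\mathcal M^{-1}x,y\rangle$, $\|x\|_{\mathcal M^{-1}}=\langle x,x\rangle_{\mathcal M^{-1}}^{1/2}$ and $\mu(X)=\inf_{0\ne z\in\mathbb R^{n+m}}\langle Xz,z\rangle_{\mathcal M^{-1}}/\langle z,z\rangle_{\mathcal M^{-1}}$. Then there are constants $c,\tilde c>0$ that depend only on $\Omega$, $\delta_0$ and $R$ (in particular, not on $\mathcal T_h$ and its mesh size, $k_0$, the bases, $\nu$, $\gamma$, $\mathbf a$ and $s$) such that in every such situation $\mathcal M$ is positive definite, the matrices $A_\gamma$, $S$, $\mathcal K$ and $\widehat{\mathcal P}$ are invertible, and $$\mu(\mathcal K\widehat{\mathcal P}^{-1})=\mu\begin{pmatrix}I&0\\BA_\gamma^{-1}&S\widehat S^{-1}\end{pmatrix}\ \ge\ c\,\nu(\nu+\gamma),\qquad \mu(\widehat{\mathcal P}\mathcal K^{-1})=\mu\begin{pmatrix}I&0\\-\widehat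 SS^{-1}BA_\gamma^{-1}&\widehat SS^{-1}\end{pmatrix}\ \ge\ \frac12 .$$ Moreover $\tilde c\,\nu(\nu+\gamma)\le1$, and for every right-hand side $b$ and initial guess $x_0$ the residuals $r_k=b-\mathcal Kx_k$ of GMRES preconditioned by $\widehat{\mathcal P}$ (that is, $x_k$ minimizes $\|b-\mathcal Kx\|_{\mathcal M^{-1}}$ over $x\in x_0+\widehat{\mathcal P}^{-1}\operatorname{span}\{(\mathcal K\widehat{\mathcal P}^{-1})^jr_0:0\le j<k\}$) satisfy, for all $k\ge0$, $$\|r_k\|_{\mathcal M^{-1}}\le\bigl(1-\tilde c\,\nu(\nu+\gamma)\bigr)^{k/2}\,\|r_0\|_{\mathcal M^{-1}} .$$ -/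

import Mathlib

open MeasureTheory
open scoped ContDiff Matrix

/-! ### Domains and Sobolev spaces -/

/-- A bounded polygonal (`d = 2`) or polyhedral (`d = 3`) domain: a bounded, connected, nonempty
open set whose boundary is a finite union of (necessarily lower dimensional) convex polytopes. -/
structure PolyhedralDomain (d : ℕ) where
  carrier : Set (EuclideanSpace ℝ (Fin d))
  isOpen : IsOpen carrier
  isConnected : IsConnected carrier
  isBounded : Bornology.IsBounded carrier
  boundary : ∃ F : Finset (Finset (EuclideanSpace ℝ (Fin d))),
    frontier carrier = ⋃ S ∈ F, convexHull ℝ (S : Set (EuclideanSpace ℝ (Fin d)))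

namespace PolyhedralDomain

variable {d : ℕ}

/-- Lebesgue measure on the domain. -/
noncomputable abbrev vol (Ω : PolyhedralDomain d) : Measure (EuclideanSpace ℝ (Fin d)) :=
  volume.restrict Ω.carrier

/-- The real Hilbert space `L²(Ω)`. -/
abbrev L2 (Ω : PolyhedralDomain d) : Type := Lp ℝ 2 Ω.vol

instance (Ω : PolyhedralDomain d) : IsFiniteMeasure Ω.vol :=
  ⟨by simpa using Ω.isBounded.measure_lt_top⟩

/-- The graph `{(φ, (∂₁φ, …, ∂_dφ)) : φ ∈ C_c^∞(Ω)}` of the gradient on test functions, inside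
`L²(Ω) × L²(Ω)^d`. -/
def testGraph (Ω : PolyhedralDomain d) : Set (Ω.L2 × (Fin d → Ω.L2)) :=
  {w | ∃ φ : EuclideanSpace ℝ (Fin d) → ℝ,
    ContDiff ℝ ∞ φ ∧ HasCompactSupport φ ∧ tsupport φ ⊆ Ω.carrier ∧
    w.1 =ᵐ[Ω.vol] φ ∧
    ∀ l, w.2 l =ᵐ[Ω.vol] fun x => fderiv ℝ φ x (EuclideanSpace.single l 1)}

/-- `H¹₀(Ω)`, the closure of `C_c^∞(Ω)` in the `H¹` norm. An element is stored as the pair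
`(u, ∇u)` of a function and its weak gradient (which `u` determines), so that the `H¹` topology
is the one inherited from `L²(Ω) × L²(Ω)^d`. -/
noncomputable def H10 (Ω : PolyhedralDomain d) : Submodule ℝ (Ω.L2 × (Fin d → Ω.L2)) :=
  (Submodule.span ℝ Ω.testGraph).topologicalClosure

/-- Vector fields in `H¹₀(Ω)^d`, given by their components. -/
abbrev H10Vec (Ω : PolyhedralDomain d) : Type := Fin d → Ω.H10

variable {Ω : PolyhedralDomain d}

/-- The `c`-th component of a vector field, as an element of `L²(Ω)`. -/
noncomputable def comp (v : Ω.H10Vec) (c : Fin d) : Ω.L2 := (v c).1.1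

/-- The weak partial derivative `∂_l v_c`. -/
noncomputable def partialDeriv (v : Ω.H10Vec) (l c : Fin d) : Ω.L2 := (v c).1.2 l

/-- The divergence `∑_c ∂_c v_c`. -/
noncomputable def div (v : Ω.H10Vec) : Ω.L2 := ∑ c, partialDeriv v c c

/-- `(∇u, ∇v)`, the `L²` inner product of the gradients. -/
noncomputable def gradInner (u v : Ω.H10Vec) : ℝ :=
  ∑ c, ∑ l, inner ℝ (partialDeriv u l c) (partialDeriv v l c)

/-- `‖∇v‖`. -/
noncomputable def gradNorm (v : Ω.H10Vec) : ℝ := Real.sqrt (gradInner v v)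

/-- `b(v, q) = -(q, div v)`. -/
noncomputable def bForm (v : Ω.H10Vec) (q : Ω.L2) : ℝ := - inner ℝ q (div v)

/-- `(a · ∇u, v)`. -/
noncomputable def convection (a : EuclideanSpace ℝ (Fin d) → EuclideanSpace ℝ (Fin d))
    (u v : Ω.H10Vec) : ℝ :=
  ∫ x, ∑ c, (∑ l, a x l * partialDeriv u l c x) * comp v c x ∂Ω.vol

end PolyhedralDomain

/-! ### Elements, tessellations and finite element spaces -/

/-- The reference cube `[0,1]^d`. -/
def refCube (d : ℕ) : Set (Fin d → ℝ) := Set.Icc 0 1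

/-- The `d`-linear map from the reference cube that sends the cube's vertex `ε ∈ {0,1}^d` to
`v ε`. -/
noncomputable def cubeMap {d : ℕ} (v : (Fin d → Bool) → EuclideanSpace ℝ (Fin d))
    (ξ : Fin d → ℝ) : EuclideanSpace ℝ (Fin d) :=
  ∑ ε : Fin d → Bool, (∏ i, if ε i then ξ i else 1 - ξ i) • v ε

/-- An element, given by its vertices: a nondegenerate simplex (triangle, tetrahedron), or the
one-to-one image of the reference cube under a `d`-linear map (quadrilateral, hexahedron). -/
inductive FElement (d : ℕ) where
  | simplex (v : Fin (d + 1) → EuclideanSpace ℝ (Fin d)) (hv : AffineIndependent ℝ v)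
  | cube (v : (Fin d → Bool) → EuclideanSpace ℝ (Fin d))
      (hv : Set.InjOn (cubeMap v) (refCube d))

namespace FElement

variable {d : ℕ}

/-- The closed set of points of an element. -/
noncomputable def carrier : FElement d → Set (EuclideanSpace ℝ (Fin d))
  | simplex v _ => convexHull ℝ (Set.range v)
  | cube v _ => cubeMap v '' refCube d

/-- `F` is a face (vertex, edge, …, or the whole) of the element. -/
def IsFace : FElement d → Set (EuclideanSpace ℝ (Fin d)) → Prop
  | simplex v _, F => ∃ I : Set (Fin (d + 1)), I.Nonempty ∧ F = convexHull ℝ (v '' I)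
  | cube v _, F => ∃ (I : Set (Fin d)) (ε : Fin d → Bool),
      F = cubeMap v '' {ξ ∈ refCube d | ∀ i ∈ I, ξ i = if ε i then 1 else 0}

/-- `g` belongs, on the element, to the space `R_k`: polynomials of total degree at most `k` on
a simplex; on a quadrilateral or hexahedron, (mapped) tensor product polynomials of degree at most
`k` in each reference variable. Nothing is said about `g` outside of the element. -/
def IsShape (k : ℕ) : FElement d → (EuclideanSpace ℝ (Fin d) → ℝ) → Prop
  | simplex v hv, g => ∃ p ∈ MvPolynomial.restrictTotalDegree (Fin d) ℝ k,
      ∀ x ∈ (simplex v hv).carrier, g x = MvPolynomial.eval (fun i => x i) p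
  | cube v _, g => ∃ p ∈ MvPolynomial.restrictDegree (Fin d) ℝ k,
      ∀ ξ ∈ refCube d, g (cubeMap v ξ) = MvPolynomial.eval ξ p

lemma IsShape.zero (k : ℕ) (T : FElement d) : T.IsShape k (fun _ => 0) := by
  cases T <;> exact ⟨0, Submodule.zero_mem _, by simp⟩

lemma IsShape.add {k : ℕ} {T : FElement d} {f g : EuclideanSpace ℝ (Fin d) → ℝ}
    (hf : T.IsShape k f) (hg : T.IsShape k g) : T.IsShape k (fun x => f x + g x) := by
  cases T <;>
  · obtain ⟨p, hp, hp'⟩ := hf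
    obtain ⟨q, hq, hq'⟩ := hg
    exact ⟨p + q, Submodule.add_mem _ hp hq, fun x hx => by simp [hp' x hx, hq' x hx]⟩

lemma IsShape.smul {k : ℕ} {T : FElement d} {f : EuclideanSpace ℝ (Fin d) → ℝ}
    (r : ℝ) (hf : T.IsShape k f) : T.IsShape k (fun x => r * f x) := by
  cases T <;>
  · obtain ⟨p, hp, hp'⟩ := hf
    exact ⟨r • p, Submodule.smul_mem _ r hp, fun x hx => by simp [hp' x hx]⟩

end FElement

/-- A conforming tessellation of the domain: finitely many elements that cover its closure, do not
overlap, and meet only in common faces. -/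
structure Tessellation {d : ℕ} (Ω : PolyhedralDomain d) where
  elements : Set (FElement d)
  finite : elements.Finite
  cover : ⋃ T ∈ elements, T.carrier = closure Ω.carrier
  nonoverlapping : ∀ T ∈ elements, ∀ T' ∈ elements, T ≠ T' →
    Disjoint (interior T.carrier) (interior T'.carrier)
  conforming : ∀ T ∈ elements, ∀ T' ∈ elements, T ≠ T' →
    T.carrier ∩ T'.carrier = ∅ ∨
      (T.IsFace (T.carrier ∩ T'.carrier) ∧ T'.IsFace (T.carrier ∩ T'.carrier))

namespace Tessellation

variable {d : ℕ} {Ω : PolyhedralDomain d}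

/-- The functions `q ∈ L²(Ω)` with `q|_T ∈ R_k(T)` for all elements `T`. -/
noncomputable def piecewise (𝒯 : Tessellation Ω) (k : ℕ) : Submodule ℝ Ω.L2 where
  carrier := {q | ∀ T ∈ 𝒯.elements, ∃ g, T.IsShape k g ∧
    ∀ᵐ x ∂Ω.vol, x ∈ T.carrier → q x = g x}
  zero_mem' T _ := ⟨fun _ => 0, .zero k T, by
    filter_upwards [Lp.coeFn_zero ℝ 2 Ω.vol] with x hx _ using hx⟩
  add_mem' {p q} hp hq T hT := by
    obtain ⟨f, hf, hf'⟩ := hp T hT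
    obtain ⟨g, hg, hg'⟩ := hq T hT
    refine ⟨_, hf.add hg, ?_⟩
    filter_upwards [hf', hg', Lp.coeFn_add p q] with x h1 h2 h3 hx
    rw [h3, Pi.add_apply, h1 hx, h2 hx]
  smul_mem' r p hp T hT := by
    obtain ⟨f, hf, hf'⟩ := hp T hT
    refine ⟨_, hf.smul r, ?_⟩
    filter_upwards [hf', Lp.coeFn_smul r p] with x h1 h3 hx
    simp [h3, h1 hx]

/-- `V_h = {v ∈ H¹₀(Ω)^d : v|_T ∈ R_k(T)^d for all T}`. -/
noncomputable def velocitySpace (𝒯 : Tessellation Ω) (k : ℕ) : Submodule ℝ Ω.H10Vec where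
  carrier := {v | ∀ c, PolyhedralDomain.comp v c ∈ 𝒯.piecewise k}
  zero_mem' _ := Submodule.zero_mem _
  add_mem' hu hv c := Submodule.add_mem _ (hu c) (hv c)
  smul_mem' r _ hv c := Submodule.smul_mem _ r (hv c)

/-- `Q_h = {q ∈ L²₀(Ω) : q|_T ∈ R_k(T) for all T}`, with `L²₀` the functions of mean zero. -/
noncomputable def pressureSpace (𝒯 : Tessellation Ω) (k : ℕ) : Submodule ℝ Ω.L2 where
  carrier := {q | ∫ x, q x ∂Ω.vol = 0 ∧ q ∈ 𝒯.piecewise k}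
  zero_mem' := ⟨by
    rw [integral_congr_ae (Lp.coeFn_zero ℝ 2 Ω.vol)]; simp, Submodule.zero_mem _⟩
  add_mem' {p q} hp hq := ⟨by
    have h1 : Integrable p Ω.vol := (Lp.memLp p).integrable (by norm_num)
    have h2 : Integrable q Ω.vol := (Lp.memLp q).integrable (by norm_num)
    rw [integral_congr_ae (Lp.coeFn_add p q)]
    simp only [Pi.add_apply]
    rw [integral_add h1 h2, hp.1, hq.1, add_zero], Submodule.add_mem _ hp.2 hq.2⟩
  smul_mem' r p hp := ⟨by
    rw [integral_congr_ae (Lp.coeFn_smul r p)]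
    simp only [Pi.smul_apply, smul_eq_mul]
    rw [integral_const_mul, hp.1, mul_zero], Submodule.smul_mem _ r hp.2⟩

end Tessellation

/-! ### Weighted inner products, field of values, GMRES -/

section LinearAlgebra

variable {ι : Type} [Fintype ι] [DecidableEq ι]

/-- `⟨x, y⟩_W = ⟨W x, y⟩`. -/
def wInner (W : Matrix ι ι ℝ) (x y : ι → ℝ) : ℝ := (W *ᵥ x) ⬝ᵥ y

/-- `‖x‖_W = ⟨x, x⟩_W^{1/2}`. -/
noncomputable def wNorm (W : Matrix ι ι ℝ) (x : ι → ℝ) : ℝ := Real.sqrt (wInner W x x)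

/-- The infimum of `⟨X z, z⟩_W / ⟨z, z⟩_W` over `z ≠ 0`, as an extended real number. -/
noncomputable def fovLower (W X : Matrix ι ι ℝ) : EReal :=
  ⨅ z : {z : ι → ℝ // z ≠ 0}, ((wInner W (X *ᵥ z.1) z.1 / wInner W z.1 z.1 : ℝ) : EReal)

/-- The Krylov space `span {r, X r, …, X^{k-1} r}`. -/
def krylov (X : Matrix ι ι ℝ) (r : ι → ℝ) (k : ℕ) : Submodule ℝ (ι → ℝ) :=
  Submodule.span ℝ {w | ∃ j < k, w = (X ^ j) *ᵥ r}

/-- The affine search space `x₀ + P⁻¹ span {r₀, …, (K P⁻¹)^{k-1} r₀}`, `r₀ = b - K x₀`, of the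
`k`-th step of GMRES for `K x = b` with the (right) preconditioner `P`. -/
def gmresSpace (K P : Matrix ι ι ℝ) (b x₀ : ι → ℝ) (k : ℕ) : Set (ι → ℝ) :=
  {x | ∃ w ∈ krylov (K * P⁻¹) (b - K *ᵥ x₀) k, x = x₀ + P⁻¹ *ᵥ w}

/-- `x` is a `k`-th iterate of preconditioned GMRES in the inner product `⟨·,·⟩_W`: it minimizes
the residual norm `‖b - K x‖_W` over the search space. -/
def IsGMRESIterate (W K P : Matrix ι ι ℝ) (b x₀ : ι → ℝ) (k : ℕ) (x : ι → ℝ) : Prop :=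
  x ∈ gmresSpace K P b x₀ k ∧
    ∀ y ∈ gmresSpace K P b x₀ k, wNorm W (b - K *ᵥ x) ≤ wNorm W (b - K *ᵥ y)

end LinearAlgebra

/-! ### The discrete Oseen problem -/

/-- The data of a grad-div and pressure stabilized equal-order discretization of the Oseen problem:
viscosity `ν > 0`, grad-div parameter `γ ≥ 0`, a smooth divergence-free advection field `a` with
`‖a‖_{L^∞(Ω)} = 1`, a symmetric positive semi-definite bilinear form `s` on `L²(Ω)`, a tessellation,
the polynomial degree `k`, and bases of the spaces `V_h` and `Q_h`. -/
structure OseenDiscretization {d : ℕ} (Ω : PolyhedralDomain d) where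
  ν : ℝ
  γ : ℝ
  ν_pos : 0 < ν
  γ_nonneg : 0 ≤ γ
  a : EuclideanSpace ℝ (Fin d) → EuclideanSpace ℝ (Fin d)
  a_smooth : ContDiffOn ℝ ∞ a Ω.carrier
  a_divfree : ∀ x ∈ Ω.carrier, ∑ i, (fderiv ℝ a x (EuclideanSpace.single i 1)) i = 0
  a_norm : eLpNorm a ⊤ Ω.vol = 1
  s : LinearMap.BilinForm ℝ Ω.L2
  s_symm : ∀ p q, s p q = s q p
  s_nonneg : ∀ p, 0 ≤ s p p
  mesh : Tessellation Ω
  k : ℕ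
  n : ℕ
  m : ℕ
  ψ : Module.Basis (Fin n) ℝ (mesh.velocitySpace k)
  φ : Module.Basis (Fin m) ℝ (mesh.pressureSpace k)

namespace OseenDiscretization

open PolyhedralDomain

variable {d : ℕ} {Ω : PolyhedralDomain d} (D : OseenDiscretization Ω)

/-- The stabilized inf-sup condition with constant `δ₀`:
`sup_{0 ≠ v ∈ V_h} b(v, p) / ‖∇v‖ + s(p, p)^{1/2} ≥ δ₀ ‖p‖` for all `p ∈ Q_h`. -/
def InfSup (δ₀ : ℝ) : Prop :=
  ∀ p ∈ D.mesh.pressureSpace D.k,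
    δ₀ * ‖p‖ ≤ (⨆ v : {v : D.mesh.velocitySpace D.k // v ≠ 0},
      bForm (v.1 : Ω.H10Vec) p / gradNorm (v.1 : Ω.H10Vec)) + Real.sqrt (D.s p p)

/-- `D_ij = (∇ψ_i, ∇ψ_j)`. -/
noncomputable def matD : Matrix (Fin D.n) (Fin D.n) ℝ :=
  .of fun i j => gradInner (D.ψ i : Ω.H10Vec) (D.ψ j : Ω.H10Vec)

/-- `N_ij = (a · ∇ψ_j, ψ_i)`. -/
noncomputable def matN : Matrix (Fin D.n) (Fin D.n) ℝ :=
  .of fun i j => convection D.a (D.ψ j : Ω.H10Vec) (D.ψ i : Ω.H10Vec)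

/-- `G_ij = (div ψ_i, div ψ_j)`. -/
noncomputable def matG : Matrix (Fin D.n) (Fin D.n) ℝ :=
  .of fun i j => inner ℝ (div (D.ψ i : Ω.H10Vec)) (div (D.ψ j : Ω.H10Vec))

/-- `B_ij = -(φ_i, div ψ_j)`. -/
noncomputable def matB : Matrix (Fin D.m) (Fin D.n) ℝ :=
  .of fun i j => bForm (D.ψ j : Ω.H10Vec) (D.φ i : Ω.L2)

/-- `C_ij = (ν + γ)⁻¹ s(φ_i, φ_j)`. -/
noncomputable def matC : Matrix (Fin D.m) (Fin D.m) ℝ :=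
  .of fun i j => (D.ν + D.γ)⁻¹ * D.s (D.φ i : Ω.L2) (D.φ j : Ω.L2)

/-- The pressure mass matrix `M_ij = (φ_i, φ_j)`. -/
noncomputable def matM : Matrix (Fin D.m) (Fin D.m) ℝ :=
  .of fun i j => inner ℝ (D.φ i : Ω.L2) (D.φ j : Ω.L2)

/-- `A_γ = ν D + N + γ G`. -/
noncomputable def matA : Matrix (Fin D.n) (Fin D.n) ℝ := D.ν • D.matD + D.matN + D.γ • D.matG

/-- `A_s = (A_γ + A_γᵀ) / 2`. -/
noncomputable def matAs : Matrix (Fin D.n) (Fin D.n) ℝ := (1 / 2 : ℝ) • (D.matA + D.matAᵀ)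

/-- The Schur complement `S = B A_γ⁻¹ Bᵀ + C`. -/
noncomputable def matS : Matrix (Fin D.m) (Fin D.m) ℝ := D.matB * D.matA⁻¹ * D.matBᵀ + D.matC

/-- The Schur complement preconditioner `Ŝ = (ν + γ)⁻¹ M + C`. -/
noncomputable def matShat : Matrix (Fin D.m) (Fin D.m) ℝ := (D.ν + D.γ)⁻¹ • D.matM + D.matC

/-- The system matrix `𝒦 = [[A_γ, Bᵀ], [B, -C]]`. -/
noncomputable def matK : Matrix (Fin D.n ⊕ Fin D.m) (Fin D.n ⊕ Fin D.m) ℝ :=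
  .fromBlocks D.matA D.matBᵀ D.matB (-D.matC)

/-- The preconditioner `𝒫̂ = [[A_γ, Bᵀ], [0, -Ŝ]]`. -/
noncomputable def matP : Matrix (Fin D.n ⊕ Fin D.m) (Fin D.n ⊕ Fin D.m) ℝ :=
  .fromBlocks D.matA D.matBᵀ 0 (-D.matShat)

/-- The block diagonal matrix `ℳ = [[A_s, 0], [0, Ŝ]]`. -/
noncomputable def matCalM : Matrix (Fin D.n ⊕ Fin D.m) (Fin D.n ⊕ Fin D.m) ℝ :=
  .fromBlocks D.matAs 0 0 D.matShat

/-- `μ(X) = inf_{z ≠ 0} ⟨X z, z⟩_{ℳ⁻¹} / ⟨z, z⟩_{ℳ⁻¹}`. -/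
noncomputable def μ (X : Matrix (Fin D.n ⊕ Fin D.m) (Fin D.n ⊕ Fin D.m) ℝ) : EReal :=
  fovLower D.matCalM⁻¹ X

end OseenDiscretization

/-! The theorem reduces to a finite-dimensional statement about saddle point matrices
(`SaddlePoint`), with `Q` the mass matrix scaled by `(ν + γ)⁻¹`. Two analytic facts feed it. First,
`a · ∇` is skew on `H¹₀`, so the quadratic form of `A_γ` is `ν‖∇v‖² + γ‖div v‖²`; with `‖div v‖ ≤
‖∇v‖` this dominates `(ν + γ)‖div v‖²`, which gives the Young inequality `young` between `B`, `Q`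
and `A_s`. Second, the inf-sup condition and the continuity of `A_γ` (via Friedrichs) bound `c ν(ν +
γ) w·Ŝw` by `½ u·A_s u + w·Cw` whenever `A_γᵀu = Bᵀw` (`InfSup.schur_bound`).

The Schur form is `w·Sw = u·A_s u + w·Cw` for this `u`. For `𝒦𝒫̂⁻¹` take `w = Ŝ⁻¹y`: the form at
`(x, y)` is `x·A_s⁻¹x + x·u + u·A_s u + w·Cw`. Half of the first and third terms absorb `x·u`, and
the inf-sup bound controls the rest. For `𝒫̂𝒦⁻¹` take `w = S⁻ᵀy`, so that `y = Bu + Cw`. Then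
`young` and Cauchy–Schwarz for `C` give `y·Ŝ⁻¹y ≤ u·A_s u + w·Cw`, whence the parameter-free bound
`1/2`.

Finally, lower bounds `α` and `β` on the fields of values of `X` and `X⁻¹` make the step `e ↦ e -
βXe` contract the squared residual by `1 - αβ`, and GMRES does at least as well. -/

set_option linter.unusedSectionVars false

/-! ### Weighted inner products and minimal residual estimates. -/

section WeightedForms

variable {ι : Type} [Fintype ι]

lemma wInner_eq (W : Matrix ι ι ℝ) (x y : ι → ℝ) : wInner W x y = y ⬝ᵥ W *ᵥ x :=
  dotProduct_comm _ _

lemma wInner_comm {W : Matrix ι ι ℝ} (hW : W.IsSymm) (x y : ι → ℝ) :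
    wInner W x y = wInner W y x := by
  rw [wInner_eq, Matrix.dotProduct_mulVec, ← Matrix.mulVec_transpose, hW.eq, wInner]

lemma Matrix.PosDef.isSymm {W : Matrix ι ι ℝ} (hW : W.PosDef) : W.IsSymm := by
  have := hW.isHermitian
  rwa [Matrix.IsHermitian, Matrix.conjTranspose_eq_transpose_of_trivial] at this

lemma wInner_self_nonneg {W : Matrix ι ι ℝ} (hW : W.PosDef) (x : ι → ℝ) :
    0 ≤ wInner W x x := by
  rw [wInner_eq]
  simpa using hW.posSemidef.dotProduct_mulVec_nonneg x

lemma wInner_self_pos {W : Matrix ι ι ℝ} (hW : W.PosDef) {x : ι → ℝ} (hx : x ≠ 0) :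
    0 < wInner W x x := by
  rw [wInner_eq]
  simpa using hW.dotProduct_mulVec_pos hx

lemma wInner_sub_smul_self {W : Matrix ι ι ℝ} (hW : W.IsSymm) (x y : ι → ℝ) (t : ℝ) :
    wInner W (x - t • y) (x - t • y) =
      wInner W x x - 2 * t * wInner W y x + t ^ 2 * wInner W y y := by
  have h := wInner_comm hW x y
  simp only [wInner] at h ⊢
  simp only [Matrix.mulVec_sub, Matrix.mulVec_smul, sub_dotProduct, dotProduct_sub,
    smul_dotProduct, dotProduct_smul, smul_eq_mul, h]
  ring

/-- Avoiding the quotient keeps later estimates polynomial. For an empty index type the infimum is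
`⊤` and nothing is claimed. -/
lemma le_fovLower {W X : Matrix ι ι ℝ} (hW : W.PosDef) {c : ℝ}
    (h : ∀ z, c * wInner W z z ≤ wInner W (X *ᵥ z) z) : (c : EReal) ≤ fovLower W X := by
  refine le_iInf fun z => ?_
  rw [EReal.coe_le_coe_iff, le_div_iff₀ (wInner_self_pos hW z.2)]
  exact h z.1

variable [DecidableEq ι]

lemma krylov_mono (X : Matrix ι ι ℝ) (r : ι → ℝ) {k l : ℕ} (h : k ≤ l) :
    krylov X r k ≤ krylov X r l :=
  Submodule.span_mono fun _ ⟨j, hj, hw⟩ => ⟨j, hj.trans_le h, hw⟩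

lemma mulVec_mem_krylov_succ {X : Matrix ι ι ℝ} {r w : ι → ℝ} {k : ℕ} (hw : w ∈ krylov X r k) :
    X *ᵥ w ∈ krylov X r (k + 1) := by
  have : krylov X r k ≤ (krylov X r (k + 1)).comap X.mulVecLin := by
    refine Submodule.span_le.2 ?_
    rintro _ ⟨j, hj, rfl⟩
    refine Submodule.subset_span ⟨j + 1, by omega, ?_⟩
    simp [pow_succ', Matrix.mulVec_mulVec]
  exact this hw

/-- Minimal residual estimate: if the numerical ranges of `X` and `X⁻¹` with respect to
`⟨·,·⟩_W` lie to the right of `α` and `β`, then `k` steps reduce the squared residual by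
`(1 - α β)^k`. -/
lemma exists_krylov_residual_le {W X : Matrix ι ι ℝ} (hW : W.PosDef) {α β : ℝ} (hβ : 0 ≤ β)
    (hαβ : α * β ≤ 1) (h1 : ∀ z, α * wInner W z z ≤ wInner W (X *ᵥ z) z)
    (h2 : ∀ z, β * wInner W (X *ᵥ z) (X *ᵥ z) ≤ wInner W (X *ᵥ z) z) (r : ι → ℝ) (k : ℕ) :
    ∃ w ∈ krylov X r k,
      wInner W (r - X *ᵥ w) (r - X *ᵥ w) ≤ (1 - α * β) ^ k * wInner W r r := by
  induction k with
  | zero => exact ⟨0, Submodule.zero_mem _, by simp⟩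
  | succ k ih =>
    obtain ⟨w, hw, hle⟩ := ih
    set e := r - X *ᵥ w with he
    -- A Richardson step of length `β`: the residual `e` becomes `e - βXe`, and `h2` bounds
    -- `β²‖Xe‖²` by `β⟨Xe, e⟩`. This leaves `‖e‖² - β⟨Xe, e⟩ ≤ (1 - αβ)‖e‖²`, by `h1`.
    refine ⟨w + β • e, Submodule.add_mem _ (krylov_mono X r k.le_succ hw)
      (Submodule.smul_mem _ _ (Submodule.sub_mem _ ?_ (mulVec_mem_krylov_succ hw))), ?_⟩
    · exact Submodule.subset_span ⟨0, by omega, by simp⟩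
    · have heq : r - X *ᵥ (w + β • e) = e - β • (X *ᵥ e) := by
        rw [Matrix.mulVec_add, Matrix.mulVec_smul, he]; abel
      rw [heq, wInner_sub_smul_self hW.isSymm]
      have h3 := mul_le_mul_of_nonneg_left (h2 e) hβ
      have h4 := mul_le_mul_of_nonneg_left (h1 e) hβ
      have h5 := mul_le_mul_of_nonneg_left hle (sub_nonneg.2 hαβ)
      rw [pow_succ (1 - α * β)]
      nlinarith

/-- Convergence of preconditioned GMRES from bounds on the fields of values of `K P⁻¹` and of its
inverse. -/
lemma IsGMRESIterate.wNorm_residual_le {W K P : Matrix ι ι ℝ} (hW : W.PosDef)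
    {α β : ℝ} (hβ : 0 ≤ β) (hαβ : α * β ≤ 1)
    (h1 : ∀ z, α * wInner W z z ≤ wInner W ((K * P⁻¹) *ᵥ z) z)
    (h2 : ∀ z, β * wInner W ((K * P⁻¹) *ᵥ z) ((K * P⁻¹) *ᵥ z) ≤ wInner W ((K * P⁻¹) *ᵥ z) z)
    {b x₀ x : ι → ℝ} {k : ℕ} (hx : IsGMRESIterate W K P b x₀ k x) :
    wNorm W (b - K *ᵥ x) ≤ (1 - α * β) ^ ((k : ℝ) / 2) * wNorm W (b - K *ᵥ x₀) := by
  obtain ⟨w, hw, hle⟩ := exists_krylov_residual_le hW hβ hαβ h1 h2 (b - K *ᵥ x₀) k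
  have h0 : 0 ≤ 1 - α * β := sub_nonneg.2 hαβ
  refine (hx.2 (x₀ + P⁻¹ *ᵥ w) ⟨w, hw, rfl⟩).trans ?_
  have heq : b - K *ᵥ (x₀ + P⁻¹ *ᵥ w) = b - K *ᵥ x₀ - (K * P⁻¹) *ᵥ w := by
    rw [Matrix.mulVec_add, Matrix.mulVec_mulVec]; abel
  have hpow : (1 - α * β) ^ ((k : ℝ) / 2) = Real.sqrt ((1 - α * β) ^ k) := by
    rw [Real.sqrt_eq_rpow, ← Real.rpow_natCast, ← Real.rpow_mul h0]
    ring_nf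
  rw [heq, hpow, wNorm, wNorm, ← Real.sqrt_mul (pow_nonneg h0 k)]
  exact Real.sqrt_le_sqrt hle

lemma Matrix.PosDef.isUnit_det {W : Matrix ι ι ℝ} (hW : W.PosDef) : IsUnit W.det :=
  (Matrix.isUnit_iff_isUnit_det W).1 hW.isUnit

/-- A matrix with positive definite quadratic form is invertible. -/
lemma Matrix.isUnit_det_of_quadratic_pos {W : Matrix ι ι ℝ}
    (h : ∀ x, x ≠ 0 → 0 < x ⬝ᵥ W *ᵥ x) : IsUnit W.det := by
  rw [isUnit_iff_ne_zero]
  intro h0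
  obtain ⟨v, hv, hv0⟩ := Matrix.exists_mulVec_eq_zero_iff.2 h0
  have := h v hv
  simp [hv0] at this

/-- Young's inequality for a positive definite matrix and its inverse. -/
lemma Matrix.PosDef.neg_two_mul_dotProduct_le {W : Matrix ι ι ℝ} (hW : W.PosDef) (x u : ι → ℝ) :
    -(2 * (x ⬝ᵥ u)) ≤ wInner W⁻¹ x x + u ⬝ᵥ W *ᵥ u := by
  -- Expand the squared `W`-norm of `u + W⁻¹x`.
  have h := wInner_self_nonneg hW (u - (-1 : ℝ) • (W⁻¹ *ᵥ x))
  rw [wInner_sub_smul_self hW.isSymm] at h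
  have hx : W *ᵥ (W⁻¹ *ᵥ x) = x := by
    rw [Matrix.mulVec_mulVec, Matrix.mul_nonsing_inv _ hW.isUnit_det, Matrix.one_mulVec]
  rw [wInner_eq W u u, wInner, wInner, hx, dotProduct_comm x (W⁻¹ *ᵥ x)] at h
  rw [wInner]
  linarith

end WeightedForms

/-! ### Block triangular preconditioning of saddle point matrices. -/

section SaddlePoint

variable {n m : Type} [Fintype n] [Fintype m] [DecidableEq n] [DecidableEq m]

lemma Matrix.PosDef.fromBlocks_diagonal {U : Matrix n n ℝ} {V : Matrix m m ℝ} (hU : U.PosDef)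
    (hV : V.PosDef) : (Matrix.fromBlocks U 0 0 V).PosDef := by
  refine Matrix.PosDef.of_dotProduct_mulVec_pos ?_ fun z hz => ?_
  · rw [Matrix.IsHermitian, Matrix.fromBlocks_conjTranspose, hU.isHermitian.eq,
      hV.isHermitian.eq]
    simp
  · rw [Matrix.fromBlocks_mulVec]
    have hsplit : star z ⬝ᵥ Sum.elim (U *ᵥ (z ∘ Sum.inl) + 0 *ᵥ (z ∘ Sum.inr))
        (0 *ᵥ (z ∘ Sum.inl) + V *ᵥ (z ∘ Sum.inr)) =
        wInner U (z ∘ Sum.inl) (z ∘ Sum.inl) + wInner V (z ∘ Sum.inr) (z ∘ Sum.inr) := by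
      simp [wInner_eq, dotProduct, Fintype.sum_sum_type]
    rw [hsplit]
    by_cases h : z ∘ Sum.inl = 0
    · have h' : z ∘ Sum.inr ≠ 0 := by
        intro h'
        apply hz
        ext (i | j)
        · exact congrFun h i
        · exact congrFun h' j
      exact add_pos_of_nonneg_of_pos (wInner_self_nonneg hU _) (wInner_self_pos hV h')
    · exact add_pos_of_pos_of_nonneg (wInner_self_pos hU h) (wInner_self_nonneg hV _)

lemma wInner_fromBlocks_diagonal (U : Matrix n n ℝ) (V : Matrix m m ℝ) (x x' : n → ℝ)
    (y y' : m → ℝ) :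
    wInner (Matrix.fromBlocks U 0 0 V) (Sum.elim x y) (Sum.elim x' y') =
      wInner U x x' + wInner V y y' := by
  rw [wInner, Matrix.fromBlocks_mulVec]
  simp [wInner, dotProduct, Fintype.sum_sum_type]

lemma Matrix.inv_fromBlocks_diagonal {U : Matrix n n ℝ} {V : Matrix m m ℝ} (hU : IsUnit U.det)
    (hV : IsUnit V.det) :
    (Matrix.fromBlocks U 0 0 V)⁻¹ = Matrix.fromBlocks U⁻¹ 0 0 V⁻¹ := by
  refine Matrix.inv_eq_left_inv ?_
  simp [Matrix.fromBlocks_multiply, Matrix.nonsing_inv_mul _ hU, Matrix.nonsing_inv_mul _ hV]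

/-- The hypotheses on the blocks of a saddle point system under which the block triangular
preconditioner is analysed. `As` is the symmetric part of `A`, and `Q` is the scaled mass matrix
of the multiplier space. -/
structure SaddlePoint (A As : Matrix n n ℝ) (B : Matrix m n ℝ) (C Q : Matrix m m ℝ) : Prop where
  symmPart : ∀ x, x ⬝ᵥ A *ᵥ x = x ⬝ᵥ As *ᵥ x
  posDef_As : As.PosDef
  posDef_Q : Q.PosDef
  posSemidef_C : C.PosSemidef
  young : ∀ q x, 2 * (q ⬝ᵥ B *ᵥ x) ≤ q ⬝ᵥ Q *ᵥ q + x ⬝ᵥ As *ᵥ x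

namespace SaddlePoint

variable {A As : Matrix n n ℝ} {B : Matrix m n ℝ} {C Q : Matrix m m ℝ}

lemma posDef_add (h : SaddlePoint A As B C Q) : (Q + C).PosDef :=
  h.posDef_Q.add_posSemidef h.posSemidef_C

lemma isUnit_det (h : SaddlePoint A As B C Q) : IsUnit A.det :=
  Matrix.isUnit_det_of_quadratic_pos fun x hx => by
    rw [h.symmPart, ← wInner_eq]
    exact wInner_self_pos h.posDef_As hx

lemma transpose_mulVec_inv (h : SaddlePoint A As B C Q) (f : n → ℝ) :
    Aᵀ *ᵥ (A⁻¹ᵀ *ᵥ f) = f := by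
  rw [Matrix.mulVec_mulVec, ← Matrix.transpose_mul, Matrix.nonsing_inv_mul _ h.isUnit_det]
  simp

/-- With `u = A⁻ᵀf` one has `f = Aᵀu`, so `f·A⁻¹f = u·Aᵀu = u·Au`, and the skew part of `A` drops
out. -/
lemma dotProduct_inv_mulVec (h : SaddlePoint A As B C Q) (f : n → ℝ) :
    f ⬝ᵥ A⁻¹ *ᵥ f = (A⁻¹ᵀ *ᵥ f) ⬝ᵥ As *ᵥ (A⁻¹ᵀ *ᵥ f) := by
  rw [← h.symmPart, Matrix.dotProduct_mulVec (A⁻¹ᵀ *ᵥ f), ← Matrix.mulVec_transpose A,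
    h.transpose_mulVec_inv, Matrix.mulVec_transpose, Matrix.dotProduct_mulVec, dotProduct_comm]

/-- The quadratic form of the Schur complement. -/
lemma dotProduct_schur_mulVec (h : SaddlePoint A As B C Q) (w : m → ℝ) :
    w ⬝ᵥ (B * A⁻¹ * Bᵀ + C) *ᵥ w =
      (A⁻¹ᵀ *ᵥ (Bᵀ *ᵥ w)) ⬝ᵥ As *ᵥ (A⁻¹ᵀ *ᵥ (Bᵀ *ᵥ w)) + w ⬝ᵥ C *ᵥ w := by
  rw [← h.dotProduct_inv_mulVec, Matrix.add_mulVec, dotProduct_add, ← Matrix.mulVec_mulVec,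
    ← Matrix.mulVec_mulVec, Matrix.dotProduct_mulVec w B, ← Matrix.mulVec_transpose B]

/-- `hinf` is the matrix form of the inf-sup condition. Its right-hand side is at most the Schur
form `w·Sw`, so `S` is definite, though not symmetric in general. -/
lemma isUnit_det_schur (h : SaddlePoint A As B C Q) {ε : ℝ} (hε : 0 < ε)
    (hinf : ∀ w u, Aᵀ *ᵥ u = Bᵀ *ᵥ w →
      ε * (w ⬝ᵥ (Q + C) *ᵥ w) ≤ 1 / 2 * (u ⬝ᵥ As *ᵥ u) + w ⬝ᵥ C *ᵥ w) :
    IsUnit (B * A⁻¹ * Bᵀ + C).det :=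
  Matrix.isUnit_det_of_quadratic_pos fun w hw => by
    rw [h.dotProduct_schur_mulVec]
    have h1 := hinf w _ (h.transpose_mulVec_inv _)
    have h2 := wInner_self_pos h.posDef_add hw
    have h3 := wInner_self_nonneg h.posDef_As (A⁻¹ᵀ *ᵥ (Bᵀ *ᵥ w))
    rw [wInner_eq] at h2 h3
    have := mul_pos hε h2
    linarith

lemma isUnit_det_system (h : SaddlePoint A As B C Q) (hS : IsUnit (B * A⁻¹ * Bᵀ + C).det) :
    IsUnit (Matrix.fromBlocks A Bᵀ B (-C)).det := by
  have := Matrix.invertibleOfIsUnitDet A h.isUnit_det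
  rw [Matrix.det_fromBlocks₁₁, Matrix.invOf_eq_nonsing_inv,
    show -C - B * A⁻¹ * Bᵀ = -(B * A⁻¹ * Bᵀ + C) by abel, Matrix.det_neg]
  exact h.isUnit_det.mul (((isUnit_one.neg).pow _).mul hS)

lemma isUnit_det_preconditioner (h : SaddlePoint A As B C Q) :
    IsUnit (Matrix.fromBlocks A Bᵀ 0 (-(Q + C))).det := by
  rw [Matrix.det_fromBlocks_zero₂₁, Matrix.det_neg]
  exact h.isUnit_det.mul (((isUnit_one.neg).pow _).mul h.posDef_add.isUnit_det)

/-- Block elimination: the right-hand side is the lower triangular factor `L` in `𝒦 = L𝒫`. -/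
lemma system_mul_inv_preconditioner (h : SaddlePoint A As B C Q) :
    Matrix.fromBlocks A Bᵀ B (-C) * (Matrix.fromBlocks A Bᵀ 0 (-(Q + C)))⁻¹ =
      Matrix.fromBlocks 1 0 (B * A⁻¹) ((B * A⁻¹ * Bᵀ + C) * (Q + C)⁻¹) := by
  have key : Matrix.fromBlocks 1 0 (B * A⁻¹) ((B * A⁻¹ * Bᵀ + C) * (Q + C)⁻¹) *
      Matrix.fromBlocks A Bᵀ 0 (-(Q + C)) = Matrix.fromBlocks A Bᵀ B (-C) := by
    simp only [Matrix.fromBlocks_multiply, Matrix.one_mul, Matrix.zero_mul, Matrix.mul_zero,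
      Matrix.mul_neg, neg_zero, add_zero]
    rw [Matrix.nonsing_inv_mul_cancel_right _ _ h.posDef_add.isUnit_det,
      Matrix.nonsing_inv_mul_cancel_right _ _ h.isUnit_det,
      show B * A⁻¹ * Bᵀ + -(B * A⁻¹ * Bᵀ + C) = -C by abel]
  rw [← key, Matrix.mul_nonsing_inv_cancel_right _ _ h.isUnit_det_preconditioner]

lemma preconditioner_mul_inv_system (h : SaddlePoint A As B C Q)
    (hS : IsUnit (B * A⁻¹ * Bᵀ + C).det) :
    Matrix.fromBlocks A Bᵀ 0 (-(Q + C)) * (Matrix.fromBlocks A Bᵀ B (-C))⁻¹ =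
      Matrix.fromBlocks 1 0 (-((Q + C) * (B * A⁻¹ * Bᵀ + C)⁻¹ * B * A⁻¹))
        ((Q + C) * (B * A⁻¹ * Bᵀ + C)⁻¹) := by
  have key : Matrix.fromBlocks 1 0 (-((Q + C) * (B * A⁻¹ * Bᵀ + C)⁻¹ * B * A⁻¹))
        ((Q + C) * (B * A⁻¹ * Bᵀ + C)⁻¹) * Matrix.fromBlocks A Bᵀ B (-C) =
      Matrix.fromBlocks A Bᵀ 0 (-(Q + C)) := by
    simp only [Matrix.fromBlocks_multiply, Matrix.one_mul, Matrix.zero_mul,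
      Matrix.mul_neg, Matrix.neg_mul, neg_zero, add_zero]
    have : (Q + C) * (B * A⁻¹ * Bᵀ + C)⁻¹ * B * A⁻¹ * Bᵀ +
        (Q + C) * (B * A⁻¹ * Bᵀ + C)⁻¹ * C = Q + C := by
      rw [Matrix.mul_assoc _ B, Matrix.mul_assoc _ (B * A⁻¹), ← Matrix.mul_add,
        Matrix.nonsing_inv_mul_cancel_right _ _ hS]
    rw [Matrix.nonsing_inv_mul_cancel_right _ _ h.isUnit_det, ← neg_add, this, neg_add_cancel]
  rw [← key, Matrix.mul_nonsing_inv_cancel_right _ _ (h.isUnit_det_system hS)]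

/-- Lower bound for the field of values of `𝒦 𝒫⁻¹`. -/
lemma wInner_system_mul_inv_preconditioner (h : SaddlePoint A As B C Q) {ε : ℝ} (hε : ε ≤ 1 / 2)
    (hinf : ∀ w u, Aᵀ *ᵥ u = Bᵀ *ᵥ w →
      ε * (w ⬝ᵥ (Q + C) *ᵥ w) ≤ 1 / 2 * (u ⬝ᵥ As *ᵥ u) + w ⬝ᵥ C *ᵥ w) (z : n ⊕ m → ℝ) :
    ε * wInner (Matrix.fromBlocks As 0 0 (Q + C))⁻¹ z z ≤
      wInner (Matrix.fromBlocks As 0 0 (Q + C))⁻¹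
        (Matrix.fromBlocks 1 0 (B * A⁻¹) ((B * A⁻¹ * Bᵀ + C) * (Q + C)⁻¹) *ᵥ z) z := by
  obtain ⟨x, y, rfl⟩ : ∃ x y, z = Sum.elim x y := ⟨_, _, (Sum.elim_comp_inl_inr z).symm⟩
  rw [Matrix.inv_fromBlocks_diagonal h.posDef_As.isUnit_det h.posDef_add.isUnit_det,
    Matrix.fromBlocks_mulVec]
  simp only [Sum.elim_comp_inl, Sum.elim_comp_inr, Matrix.one_mulVec, Matrix.zero_mulVec, add_zero]
  rw [wInner_fromBlocks_diagonal, wInner_fromBlocks_diagonal,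
    wInner_comm h.posDef_add.inv.isSymm (_ + _) y]
  -- In these variables the `y`-part of the form becomes `x·u + u·As u + w·Cw` (`e2`), with `Aᵀu =
  -- Bᵀw` as `hinf` requires.
  set w := (Q + C)⁻¹ *ᵥ y with hw
  set u := A⁻¹ᵀ *ᵥ (Bᵀ *ᵥ w) with hu
  have hy : (Q + C) *ᵥ w = y := by
    rw [hw, Matrix.mulVec_mulVec, Matrix.mul_nonsing_inv _ h.posDef_add.isUnit_det,
      Matrix.one_mulVec]
  have e1 : wInner (Q + C)⁻¹ y y = w ⬝ᵥ (Q + C) *ᵥ w := by rw [hy, wInner]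
  have e2 : wInner (Q + C)⁻¹ y ((B * A⁻¹) *ᵥ x + ((B * A⁻¹ * Bᵀ + C) * (Q + C)⁻¹) *ᵥ y) =
      x ⬝ᵥ u + (u ⬝ᵥ As *ᵥ u + w ⬝ᵥ C *ᵥ w) := by
    rw [wInner, ← hw, dotProduct_add, ← Matrix.mulVec_mulVec, ← Matrix.mulVec_mulVec, ← hw,
      h.dotProduct_schur_mulVec, Matrix.dotProduct_mulVec, ← Matrix.mulVec_transpose,
      Matrix.dotProduct_mulVec, ← Matrix.mulVec_transpose, dotProduct_comm _ x]
  -- Young's inequality costs half of `x·As⁻¹x` and half of `u·As u`. The remaining half of `u·As u`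
  -- is what `hinf` asks for, and `ε ≤ 1/2` covers the `x` block.
  have h1 := hinf w u (h.transpose_mulVec_inv _)
  have h2 := h.posDef_As.neg_two_mul_dotProduct_le x u
  have h3 := mul_le_mul_of_nonneg_right hε (wInner_self_nonneg h.posDef_As.inv x)
  rw [e1, e2]
  linarith

/-- Lower bound for the field of values of `𝒫 𝒦⁻¹`. -/
lemma wInner_preconditioner_mul_inv_system (h : SaddlePoint A As B C Q)
    (hS : IsUnit (B * A⁻¹ * Bᵀ + C).det) (z : n ⊕ m → ℝ) :
    1 / 2 * wInner (Matrix.fromBlocks As 0 0 (Q + C))⁻¹ z z ≤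
      wInner (Matrix.fromBlocks As 0 0 (Q + C))⁻¹
        (Matrix.fromBlocks 1 0 (-((Q + C) * (B * A⁻¹ * Bᵀ + C)⁻¹ * B * A⁻¹))
          ((Q + C) * (B * A⁻¹ * Bᵀ + C)⁻¹) *ᵥ z) z := by
  obtain ⟨x, y, rfl⟩ : ∃ x y, z = Sum.elim x y := ⟨_, _, (Sum.elim_comp_inl_inr z).symm⟩
  rw [Matrix.inv_fromBlocks_diagonal h.posDef_As.isUnit_det h.posDef_add.isUnit_det,
    Matrix.fromBlocks_mulVec]
  simp only [Sum.elim_comp_inl, Sum.elim_comp_inr, Matrix.one_mulVec, Matrix.zero_mulVec, add_zero]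
  rw [wInner_fromBlocks_diagonal, wInner_fromBlocks_diagonal]
  have hsymmC : Cᵀ = C := by
    simpa [Matrix.IsHermitian, Matrix.conjTranspose_eq_transpose_of_trivial] using
      h.posSemidef_C.isHermitian
  set S := B * A⁻¹ * Bᵀ + C with hSdef
  set q := (Q + C)⁻¹ *ᵥ y with hq
  -- The transposed inverse turns `y·S⁻¹y` into the Schur form at `w`, and the coupling term into
  -- `-(x·u)`.
  set w := S⁻¹ᵀ *ᵥ y with hw
  set u := A⁻¹ᵀ *ᵥ (Bᵀ *ᵥ w) with hu
  have hyS : Sᵀ *ᵥ w = y := by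
    rw [hw, Matrix.mulVec_mulVec, ← Matrix.transpose_mul, Matrix.nonsing_inv_mul _ hS]
    simp
  have hyB : y = B *ᵥ u + C *ᵥ w := by
    conv_lhs => rw [← hyS, hSdef]
    rw [Matrix.transpose_add, Matrix.transpose_mul, Matrix.transpose_mul,
      Matrix.transpose_transpose, Matrix.add_mulVec, hsymmC, hu,
      ← Matrix.mulVec_mulVec, ← Matrix.mulVec_mulVec]
  have hyq : (Q + C) *ᵥ q = y := by
    rw [hq, Matrix.mulVec_mulVec, Matrix.mul_nonsing_inv _ h.posDef_add.isUnit_det,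
      Matrix.one_mulVec]
  have e2 : wInner (Q + C)⁻¹ ((-((Q + C) * S⁻¹ * B * A⁻¹)) *ᵥ x + ((Q + C) * S⁻¹) *ᵥ y) y =
      -(x ⬝ᵥ u) + (u ⬝ᵥ As *ᵥ u + w ⬝ᵥ C *ᵥ w) := by
    have e3 : (Q + C)⁻¹ *ᵥ ((-((Q + C) * S⁻¹ * B * A⁻¹)) *ᵥ x + ((Q + C) * S⁻¹) *ᵥ y) =
        -(S⁻¹ *ᵥ B *ᵥ A⁻¹ *ᵥ x) + S⁻¹ *ᵥ y := by
      rw [Matrix.mulVec_add, Matrix.mulVec_mulVec, Matrix.mulVec_mulVec, Matrix.mul_neg,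
        Matrix.neg_mulVec, Matrix.mulVec_mulVec, Matrix.mulVec_mulVec]
      simp only [Matrix.mul_assoc]
      rw [Matrix.nonsing_inv_mul_cancel_left _ _ h.posDef_add.isUnit_det,
        Matrix.nonsing_inv_mul_cancel_left _ _ h.posDef_add.isUnit_det]
    have e4 : (S⁻¹ *ᵥ y) ⬝ᵥ y = u ⬝ᵥ As *ᵥ u + w ⬝ᵥ C *ᵥ w := by
      rw [← h.dotProduct_schur_mulVec, ← hSdef, Matrix.dotProduct_mulVec,
        ← Matrix.mulVec_transpose, hyS, dotProduct_comm, Matrix.dotProduct_mulVec,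
        ← Matrix.mulVec_transpose, ← hw, dotProduct_comm]
    rw [wInner, e3, add_dotProduct, e4, neg_dotProduct, dotProduct_comm _ y,
      Matrix.dotProduct_mulVec, ← Matrix.mulVec_transpose, ← hw,
      Matrix.dotProduct_mulVec, ← Matrix.mulVec_transpose,
      Matrix.dotProduct_mulVec, ← Matrix.mulVec_transpose, ← hu, dotProduct_comm u]
  have e1 : wInner (Q + C)⁻¹ y y = q ⬝ᵥ y := by rw [wInner]
  have e5 : q ⬝ᵥ y = q ⬝ᵥ Q *ᵥ q + q ⬝ᵥ C *ᵥ q := by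
    conv_lhs => rw [← hyq, Matrix.add_mulVec, dotProduct_add]
  -- Two expressions for `q·y = y·(Q + C)⁻¹y`: by `young` and the semidefiniteness of `C`, the
  -- second is at most half the first plus `½(u·As u + w·Cw)`. Hence `q·y ≤ u·As u + w·Cw`.
  have e6 : q ⬝ᵥ y = q ⬝ᵥ B *ᵥ u + q ⬝ᵥ C *ᵥ w := by
    conv_lhs => rw [hyB, dotProduct_add]
  have h1 := h.young q u
  have h2 : 0 ≤ q ⬝ᵥ C *ᵥ q - 2 * (q ⬝ᵥ C *ᵥ w) + w ⬝ᵥ C *ᵥ w := by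
    have := h.posSemidef_C.dotProduct_mulVec_nonneg (q - w)
    have hc : w ⬝ᵥ C *ᵥ q = q ⬝ᵥ C *ᵥ w := by
      rw [← wInner_eq, wInner_comm hsymmC, wInner_eq]
    simp only [star_trivial, Matrix.mulVec_sub, dotProduct_sub, sub_dotProduct, hc] at this
    linarith
  have h3 := h.posDef_As.neg_two_mul_dotProduct_le x (-u)
  have h4 : 0 ≤ w ⬝ᵥ C *ᵥ w := by
    simpa using h.posSemidef_C.dotProduct_mulVec_nonneg w
  simp only [dotProduct_neg, Matrix.mulVec_neg, neg_dotProduct, neg_neg, mul_neg] at h3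
  rw [e1, e2]
  linarith

end SaddlePoint

end SaddlePoint

/-! ### Analysis on `H¹₀(Ω)`: Friedrichs, divergence and convection estimates. -/

namespace PolyhedralDomain

variable {d : ℕ} {Ω : PolyhedralDomain d}

/-! ### Integration by parts against test functions -/

lemma integrable_mul_of_tsupport_subset {f g : EuclideanSpace ℝ (Fin d) → ℝ}
    (hf : ContinuousOn f Ω.carrier) (hg : Continuous g) (hgc : HasCompactSupport g)
    (hgs : tsupport g ⊆ Ω.carrier) : Integrable (fun x => f x * g x) := by
  have h : IntegrableOn (fun x => f x * g x) (tsupport g) :=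
    ((hf.mono hgs).mul hg.continuousOn).integrableOn_compact hgc
  refine (integrableOn_iff_integrable_of_support_subset fun x hx => ?_).1 h
  exact subset_tsupport g (right_ne_zero_of_mul hx)

lemma setIntegral_carrier_eq {f g : EuclideanSpace ℝ (Fin d) → ℝ}
    (hgs : tsupport g ⊆ Ω.carrier) : ∫ x, f x * g x ∂Ω.vol = ∫ x, f x * g x :=
  setIntegral_eq_integral_of_forall_compl_eq_zero fun x hx => by
    rw [image_eq_zero_of_notMem_tsupport fun h => hx (hgs h), mul_zero]

lemma tsupport_fderiv_apply_subset {g : EuclideanSpace ℝ (Fin d) → ℝ}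
    (v : EuclideanSpace ℝ (Fin d)) : tsupport (fun x => fderiv ℝ g x v) ⊆ tsupport g :=
  (closure_mono fun x (hx : fderiv ℝ g x v ≠ 0) (h : fderiv ℝ g x = 0) =>
    hx (by rw [h]; rfl)).trans (tsupport_fderiv_subset ℝ (f := g))

/-- Integration by parts against a function with compact support in the domain. -/
lemma integral_mul_fderiv_eq_neg {f g : EuclideanSpace ℝ (Fin d) → ℝ}
    (hf : ContDiffOn ℝ 1 f Ω.carrier) (hg : ContDiff ℝ 1 g) (hgc : HasCompactSupport g)
    (hgs : tsupport g ⊆ Ω.carrier) (v : EuclideanSpace ℝ (Fin d)) :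
    ∫ x, f x * fderiv ℝ g x v ∂Ω.vol = - ∫ x, fderiv ℝ f x v * g x ∂Ω.vol := by
  have hg' : Continuous fun x => fderiv ℝ g x v :=
    (hg.continuous_fderiv one_ne_zero).clm_apply continuous_const
  have hgs' := (tsupport_fderiv_apply_subset (g := g) v).trans hgs
  have hgc' : HasCompactSupport fun x => fderiv ℝ g x v :=
    hgc.of_isClosed_subset (isClosed_tsupport _) (tsupport_fderiv_apply_subset v)
  have hf' : ContinuousOn (fun x => fderiv ℝ f x v) Ω.carrier :=
    (hf.continuousOn_fderiv_of_isOpen Ω.isOpen le_rfl).clm_apply continuousOn_const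
  -- As `g` is supported inside the domain, the integrals extend to the whole space; `f` needs to be
  -- differentiable only on the support of `g`, whatever its values outside the domain.
  rw [setIntegral_carrier_eq hgs', setIntegral_carrier_eq hgs]
  exact integral_mul_fderiv_eq_neg_fderiv_mul_of_integrable
    (integrable_mul_of_tsupport_subset hf' hg.continuous hgc hgs)
    (integrable_mul_of_tsupport_subset hf.continuousOn hg' hgc' hgs')
    (integrable_mul_of_tsupport_subset hf.continuousOn hg.continuous hgc hgs)
    (fun x hx => (hf.differentiableOn one_ne_zero).differentiableAt
      (Ω.isOpen.mem_nhds (hgs hx)))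
    (fun x _ => hg.differentiable one_ne_zero x)

/-! ### Multiplication operators -/

/-- Multiplication by an essentially bounded function on `L²(Ω)`. -/
noncomputable def mulL {f : EuclideanSpace ℝ (Fin d) → ℝ} (hf : MemLp f ⊤ Ω.vol) :
    Ω.L2 →L[ℝ] Ω.L2 :=
  (ContinuousLinearMap.mul ℝ ℝ).holderL Ω.vol ⊤ 2 2 (hf.toLp f)

lemma coeFn_mulL {f : EuclideanSpace ℝ (Fin d) → ℝ} (hf : MemLp f ⊤ Ω.vol) (u : Ω.L2) :
    mulL hf u =ᵐ[Ω.vol] fun x => f x * u x := by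
  have h : mulL hf u = (ContinuousLinearMap.mul ℝ ℝ).holder 2 (hf.toLp f) u := rfl
  rw [h]
  filter_upwards [(ContinuousLinearMap.mul ℝ ℝ).coeFn_holder (r := 2) (hf.toLp f) u,
    hf.coeFn_toLp] with x h1 h2
  rw [h1, h2, ContinuousLinearMap.mul_apply']

lemma norm_mulL_apply_le {f : EuclideanSpace ℝ (Fin d) → ℝ} (hf : MemLp f ⊤ Ω.vol)
    (h1 : eLpNorm f ⊤ Ω.vol ≤ 1) (u : Ω.L2) : ‖mulL hf u‖ ≤ ‖u‖ := by
  have h : mulL hf u = (ContinuousLinearMap.mul ℝ ℝ).holder 2 (hf.toLp f) u := rfl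
  have hn : ‖hf.toLp f‖ ≤ 1 := by
    rw [Lp.norm_toLp]
    exact ENNReal.toReal_le_of_le_ofReal zero_le_one (by simpa using h1)
  rw [h]
  refine (ContinuousLinearMap.norm_holder_apply_apply_le _ _ _).trans ?_
  refine mul_le_of_le_one_left (norm_nonneg _) ?_
  exact mul_le_one₀ (ContinuousLinearMap.opNorm_mul_le ℝ ℝ) (norm_nonneg _) hn

lemma inner_eq_integral {u v : Ω.L2} {f g : EuclideanSpace ℝ (Fin d) → ℝ}
    (hu : u =ᵐ[Ω.vol] f) (hv : v =ᵐ[Ω.vol] g) : inner ℝ u v = ∫ x, f x * g x ∂Ω.vol := by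
  rw [L2.inner_def]
  refine integral_congr_ae ?_
  filter_upwards [hu, hv] with x h1 h2
  simp [h1, h2, mul_comm]

lemma inner_mulL_eq_integral {m : EuclideanSpace ℝ (Fin d) → ℝ} (hm : MemLp m ⊤ Ω.vol)
    {u v : Ω.L2} {f g : EuclideanSpace ℝ (Fin d) → ℝ}
    (hu : u =ᵐ[Ω.vol] f) (hv : v =ᵐ[Ω.vol] g) :
    inner ℝ (mulL hm u) v = ∫ x, m x * (f x * g x) ∂Ω.vol := by
  have : mulL hm u =ᵐ[Ω.vol] fun x => m x * f x := by
    filter_upwards [coeFn_mulL hm u, hu] with x h1 h2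
    rw [h1, h2]
  rw [inner_eq_integral this hv]
  simp_rw [mul_assoc]

/-! ### Bilinear identities on `H¹₀` -/

/-- A continuous bilinear form that vanishes on test functions vanishes on `H¹₀(Ω)`. -/
lemma bilin_eq_zero_of_testGraph
    (β : (Ω.L2 × (Fin d → Ω.L2)) →L[ℝ] (Ω.L2 × (Fin d → Ω.L2)) →L[ℝ] ℝ)
    (h : ∀ w ∈ Ω.testGraph, ∀ w' ∈ Ω.testGraph, β w w' = 0) (u v : Ω.H10) :
    β u.1 v.1 = 0 := by
  -- Density in one variable: the kernel of a continuous functional is closed. It is used for `u`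
  -- with `v` fixed, then for `v` with a test function fixed.
  have key : ∀ ℓ : (Ω.L2 × (Fin d → Ω.L2)) →L[ℝ] ℝ, (∀ w ∈ Ω.testGraph, ℓ w = 0) →
      ∀ w ∈ Ω.H10, ℓ w = 0 := fun ℓ hℓ w hw => by
    have : Ω.H10 ≤ LinearMap.ker (ℓ : (Ω.L2 × (Fin d → Ω.L2)) →ₗ[ℝ] ℝ) :=
      Submodule.topologicalClosure_minimal _ (Submodule.span_le.2 fun w hw => hℓ w hw)
        ℓ.isClosed_ker
    exact this hw
  refine key (β.flip v.1) (fun w hw => ?_) u.1 u.2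
  exact key (β w) (h w hw) v.1 v.2

/-- The continuous bilinear form `(u, v) ↦ (S u, T v)` on `L²(Ω) × L²(Ω)^d`. -/
noncomputable def innerForm (S T : (Ω.L2 × (Fin d → Ω.L2)) →L[ℝ] Ω.L2) :
    (Ω.L2 × (Fin d → Ω.L2)) →L[ℝ] (Ω.L2 × (Fin d → Ω.L2)) →L[ℝ] ℝ :=
  (innerSL ℝ).bilinearComp S T

/-- The function component of a pair `(u, ∇u)`. -/
noncomputable def fnL : (Ω.L2 × (Fin d → Ω.L2)) →L[ℝ] Ω.L2 := ContinuousLinearMap.fst ℝ _ _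

/-- The `l`-th derivative of a pair `(u, ∇u)`. -/
noncomputable def derivL (l : Fin d) : (Ω.L2 × (Fin d → Ω.L2)) →L[ℝ] Ω.L2 :=
  (ContinuousLinearMap.proj l).comp (ContinuousLinearMap.snd ℝ _ _)

/-- This is where boundedness of the domain yields a finite Friedrichs constant. -/
lemma memLp_coord (i : Fin d) :
    MemLp (fun x : EuclideanSpace ℝ (Fin d) => x i) ⊤ Ω.vol := by
  obtain ⟨L, hL⟩ := Ω.isBounded.exists_norm_le
  refine memLp_top_of_bound (by fun_prop) L ?_
  filter_upwards [ae_restrict_mem Ω.isOpen.measurableSet] with x hx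
  exact (PiLp.norm_apply_le x i).trans (hL x hx)

lemma fderiv_coord (i : Fin d) (x v : EuclideanSpace ℝ (Fin d)) :
    fderiv ℝ (fun y : EuclideanSpace ℝ (Fin d) => y i) x v = v i := by
  have : (fun y : EuclideanSpace ℝ (Fin d) => y i) = EuclideanSpace.proj (𝕜 := ℝ) i := rfl
  rw [this, ContinuousLinearMap.fderiv]
  rfl

lemma fderiv_mul_apply {f g : EuclideanSpace ℝ (Fin d) → ℝ} (hf : ContDiff ℝ ∞ f)
    (hg : ContDiff ℝ ∞ g) (x v : EuclideanSpace ℝ (Fin d)) :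
    fderiv ℝ (fun y => f y * g y) x v = fderiv ℝ f x v * g x + f x * fderiv ℝ g x v := by
  rw [fderiv_fun_mul (hf.differentiable (by simp) x) (hg.differentiable (by simp) x)]
  simp
  ring

/-- Integration by parts against a product of two test functions. -/
lemma integral_mul_fderiv_mul_add {f φ χ : EuclideanSpace ℝ (Fin d) → ℝ}
    (hf : ContDiffOn ℝ 1 f Ω.carrier) (hφ : ContDiff ℝ ∞ φ) (hφc : HasCompactSupport φ)
    (hφs : tsupport φ ⊆ Ω.carrier) (hχ : ContDiff ℝ ∞ χ) (v : EuclideanSpace ℝ (Fin d)) :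
    ∫ x, f x * (fderiv ℝ φ x v * χ x) ∂Ω.vol + ∫ x, f x * (φ x * fderiv ℝ χ x v) ∂Ω.vol =
      - ∫ x, fderiv ℝ f x v * (φ x * χ x) ∂Ω.vol := by
  have hs : tsupport (fun x => φ x * χ x) ⊆ tsupport φ := tsupport_mul_subset_left
  have hc : HasCompactSupport fun x => φ x * χ x := hφc.mul_right
  rw [← integral_mul_fderiv_eq_neg hf ((hφ.mul hχ).of_le (by simp)) hc (hs.trans hφs) v]
  have hφ' : Continuous fun x => fderiv ℝ φ x v :=
    (hφ.continuous_fderiv (by simp)).clm_apply continuous_const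
  have hχ' : Continuous fun x => fderiv ℝ χ x v :=
    (hχ.continuous_fderiv (by simp)).clm_apply continuous_const
  have hφs' := tsupport_fderiv_apply_subset (g := φ) v
  have hφc' : HasCompactSupport fun x => fderiv ℝ φ x v :=
    hφc.of_isClosed_subset (isClosed_tsupport _) hφs'
  rw [← integral_add]
  · simp_rw [fderiv_mul_apply hφ hχ, mul_add]
  · exact (integrable_mul_of_tsupport_subset hf.continuousOn (hφ'.mul hχ.continuous)
      hφc'.mul_right ((tsupport_mul_subset_left.trans hφs').trans hφs)).integrableOn
  · exact (integrable_mul_of_tsupport_subset hf.continuousOn (hφ.continuous.mul hχ')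
      hφc.mul_right (tsupport_mul_subset_left.trans hφs)).integrableOn

/-- `∫ v ∂ᵢ(xᵢ u) + ∫ xᵢ u ∂ᵢ v = 0`, written out. -/
lemma inner_add_inner_coord (i : Fin d) (u v : Ω.H10) :
    inner ℝ u.1.1 v.1.1 + inner ℝ (mulL (memLp_coord i) (u.1.2 i)) v.1.1 +
      inner ℝ (mulL (memLp_coord i) u.1.1) (v.1.2 i) = 0 := by
  refine bilin_eq_zero_of_testGraph (innerForm fnL fnL +
    innerForm ((mulL (memLp_coord i)).comp (derivL i)) fnL +
    innerForm ((mulL (memLp_coord i)).comp fnL) (derivL i)) ?_ u v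
  rintro w ⟨φ, hφ, hφc, hφs, hw1, hw2⟩ w' ⟨χ, hχ, hχc, hχs, hw1', hw2'⟩
  change inner ℝ w.1 w'.1 + inner ℝ (mulL (memLp_coord i) (w.2 i)) w'.1 +
    inner ℝ (mulL (memLp_coord i) w.1) (w'.2 i) = 0
  rw [inner_eq_integral hw1 hw1', inner_mulL_eq_integral _ (hw2 i) hw1',
    inner_mulL_eq_integral _ hw1 (hw2' i), add_assoc,
    integral_mul_fderiv_mul_add (f := fun x => x i) (ContDiff.contDiffOn (by fun_prop))
      hφ hφc hφs hχ]
  simp [fderiv_coord]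

lemma contDiff_one_fderiv {χ : EuclideanSpace ℝ (Fin d) → ℝ} (hχ : ContDiff ℝ ∞ χ) :
    ContDiff ℝ 1 (fderiv ℝ χ) := by
  refine hχ.fderiv_right (m := 1) ?_
  rw [one_add_one_eq_two]
  exact (WithTop.coe_le_coe (b := (2 : ℕ∞))).2 le_top

/-- `(∂ᵢu, ∂ⱼv) = (∂ⱼu, ∂ᵢv)` in `H¹₀(Ω)`. -/
lemma inner_deriv_comm (i j : Fin d) (u v : Ω.H10) :
    inner ℝ (u.1.2 i) (v.1.2 j) = inner ℝ (u.1.2 j) (v.1.2 i) := by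
  refine sub_eq_zero.1 (bilin_eq_zero_of_testGraph (innerForm (derivL i) (derivL j) -
    innerForm (derivL j) (derivL i)) ?_ u v)
  rintro w ⟨φ, hφ, hφc, hφs, hw1, hw2⟩ w' ⟨χ, hχ, hχc, hχs, hw1', hw2'⟩
  change inner ℝ (w.2 i) (w'.2 j) - inner ℝ (w.2 j) (w'.2 i) = 0
  have hd : ∀ v, ContDiffOn ℝ 1 (fun x => fderiv ℝ χ x v) Ω.carrier := fun v =>
    ((contDiff_one_fderiv hχ).clm_apply contDiff_const).contDiffOn
  -- Both derivatives are moved onto `χ`, where second derivatives commute.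
  have key : ∀ i j, inner ℝ (w.2 i) (w'.2 j) = - ∫ x, fderiv ℝ
      (fun y => fderiv ℝ χ y (EuclideanSpace.single j 1)) x (EuclideanSpace.single i 1) *
      φ x ∂Ω.vol := fun i j => by
    rw [real_inner_comm, inner_eq_integral (hw2' j) (hw2 i),
      integral_mul_fderiv_eq_neg (hd _) (hφ.of_le (by simp)) hφc hφs]
  have hsymm : ∀ x v v', fderiv ℝ (fun y => fderiv ℝ χ y v) x v' =
      fderiv ℝ (fun y => fderiv ℝ χ y v') x v := fun x v v' => by
    have hdiff : DifferentiableAt ℝ (fderiv ℝ χ) x :=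
      (contDiff_one_fderiv hχ).differentiable one_ne_zero x
    rw [fderiv_clm_apply hdiff (differentiableAt_const _),
      fderiv_clm_apply hdiff (differentiableAt_const _)]
    have := (hχ.contDiffAt (x := x)).isSymmSndFDerivAt
      (by simpa using (WithTop.coe_le_coe (b := (2 : ℕ∞))).2 le_top)
    simpa using this v' v
  rw [key i j, key j i]
  simp_rw [hsymm _ (EuclideanSpace.single j 1)]
  simp

/-- The Friedrichs constant of the domain in direction `i`. -/
noncomputable def friedrichs (Ω : PolyhedralDomain d) (i : Fin d) : ℝ :=
  2 * ‖mulL (memLp_coord (Ω := Ω) i)‖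

/-- Taking `v = u` in `inner_add_inner_coord` gives `‖u‖² ≤ 2‖xᵢ‖ ‖∂ᵢu‖ ‖u‖`, with `‖xᵢ‖` the norm
of multiplication by `xᵢ`. -/
lemma norm_le_friedrichs (i : Fin d) (u : Ω.H10) : ‖u.1.1‖ ≤ Ω.friedrichs i * ‖u.1.2 i‖ := by
  have h := inner_add_inner_coord i u u
  set T := mulL (memLp_coord (Ω := Ω) i)
  have h1 := abs_le.1 (abs_real_inner_le_norm (T (u.1.2 i)) u.1.1)
  have h2 := abs_le.1 (abs_real_inner_le_norm (T u.1.1) (u.1.2 i))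
  have h3 := mul_le_mul_of_nonneg_right (T.le_opNorm (u.1.2 i)) (norm_nonneg u.1.1)
  have h4 := mul_le_mul_of_nonneg_right (T.le_opNorm u.1.1) (norm_nonneg (u.1.2 i))
  rw [real_inner_self_eq_norm_sq] at h
  have h5 : ‖u.1.1‖ * ‖u.1.1‖ ≤ (2 * ‖T‖ * ‖u.1.2 i‖) * ‖u.1.1‖ := by nlinarith
  rcases (norm_nonneg u.1.1).eq_or_lt with h0 | h0
  · rw [← h0]; exact mul_nonneg (by unfold friedrichs; positivity) (norm_nonneg _)
  · exact le_of_mul_le_mul_right h5 h0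

/-! ### Vector fields -/

lemma gradInner_self_nonneg (v : Ω.H10Vec) : 0 ≤ gradInner v v :=
  Finset.sum_nonneg fun _ _ => Finset.sum_nonneg fun _ _ => real_inner_self_nonneg

lemma gradNorm_nonneg (v : Ω.H10Vec) : 0 ≤ gradNorm v := Real.sqrt_nonneg _

lemma gradNorm_sq (v : Ω.H10Vec) : gradNorm v ^ 2 = gradInner v v :=
  Real.sq_sqrt (gradInner_self_nonneg v)

lemma norm_partialDeriv_le (v : Ω.H10Vec) (l c : Fin d) : ‖partialDeriv v l c‖ ≤ gradNorm v := by
  refine Real.le_sqrt_of_sq_le ?_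
  rw [← real_inner_self_eq_norm_sq]
  calc inner ℝ (partialDeriv v l c) (partialDeriv v l c)
      ≤ ∑ l, inner ℝ (partialDeriv v l c) (partialDeriv v l c) :=
        Finset.single_le_sum (f := fun l => inner ℝ (partialDeriv v l c) (partialDeriv v l c))
          (fun _ _ => real_inner_self_nonneg) (Finset.mem_univ l)
    _ ≤ _ := Finset.single_le_sum
          (f := fun c => ∑ l, inner ℝ (partialDeriv v l c) (partialDeriv v l c))
          (fun _ _ => Finset.sum_nonneg fun _ _ => real_inner_self_nonneg) (Finset.mem_univ c)

lemma norm_comp_le (i : Fin d) (v : Ω.H10Vec) (c : Fin d) :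
    ‖comp v c‖ ≤ Ω.friedrichs i * gradNorm v :=
  (norm_le_friedrichs i (v c)).trans <| mul_le_mul_of_nonneg_left (norm_partialDeriv_le v i c)
    (by unfold friedrichs; positivity)

lemma abs_gradInner_le (u v : Ω.H10Vec) : |gradInner u v| ≤ gradNorm u * gradNorm v := by
  rw [← Real.sqrt_sq_eq_abs, gradNorm, gradNorm, ← Real.sqrt_mul (gradInner_self_nonneg u)]
  refine Real.sqrt_le_sqrt ?_
  -- The gradient as one vector of the Hilbert space `L²(Ω)^{d×d}`, so that ordinary Cauchy–Schwarz
  -- applies.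
  let U : Ω.H10Vec → PiLp 2 fun _ : Fin d × Fin d => Ω.L2 :=
    fun w => WithLp.toLp 2 fun p => partialDeriv w p.2 p.1
  have hU : ∀ w w', gradInner w w' = inner ℝ (U w) (U w') := fun w w' => by
    rw [PiLp.inner_apply, Fintype.sum_prod_type]
    rfl
  rw [hU, hU, hU, sq]
  exact (real_inner_mul_inner_self_le (U u) (U v))

lemma eq_zero_of_gradInner_eq_zero (i : Fin d) {v : Ω.H10Vec} (h : gradInner v v = 0) : v = 0 := by
  have h0 : gradNorm v = 0 := by rw [gradNorm, h, Real.sqrt_zero]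
  funext c
  refine Subtype.ext (Prod.ext ?_ (funext fun l => ?_))
  · have := norm_comp_le i v c
    rw [h0, mul_zero] at this
    exact norm_le_zero_iff.1 this
  · have := norm_partialDeriv_le v l c
    rw [h0] at this
    exact norm_le_zero_iff.1 this

/-- `‖div v‖ ≤ ‖∇v‖` on `H¹₀(Ω)^d`, with constant one. -/
lemma inner_div_self_le (v : Ω.H10Vec) : inner ℝ (div v) (div v) ≤ gradInner v v := by
  -- Swapping derivatives turns `(∂_c v_c, ∂_l v_l)` into `(∂_l v_c, ∂_c v_l)`. Young's inequality
  -- then bounds the double sum by `‖∇v‖²` without a dimensional factor.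
  have h1 : inner ℝ (div v) (div v) =
      ∑ c, ∑ l, inner ℝ (partialDeriv v l c) (partialDeriv v c l) := by
    simp only [div, sum_inner, inner_sum]
    refine Finset.sum_congr rfl fun c _ => Finset.sum_congr rfl fun l _ => ?_
    exact (inner_deriv_comm l c (v l) (v c)).trans (real_inner_comm _ _)
  have h2 : ∑ c, ∑ l, inner ℝ (partialDeriv v c l) (partialDeriv v c l) = gradInner v v := by
    rw [Finset.sum_comm]; rfl
  have h3 : ∑ c, ∑ l, inner ℝ (partialDeriv v l c) (partialDeriv v c l) ≤
      ∑ c, ∑ l, (1 / 2 * inner ℝ (partialDeriv v l c) (partialDeriv v l c) +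
        1 / 2 * inner ℝ (partialDeriv v c l) (partialDeriv v c l)) := by
    refine Finset.sum_le_sum fun c _ => Finset.sum_le_sum fun l _ => ?_
    have := real_inner_self_nonneg (x := partialDeriv v l c - partialDeriv v c l)
    rw [real_inner_sub_sub_self] at this
    linarith
  simp only [Finset.sum_add_distrib, ← Finset.mul_sum] at h3
  rw [h2] at h3
  change _ ≤ 1 / 2 * gradInner v v + _ at h3
  rw [h1]
  linarith

lemma norm_div_le (v : Ω.H10Vec) : ‖div v‖ ≤ gradNorm v := by
  refine Real.le_sqrt_of_sq_le ?_
  rw [← real_inner_self_eq_norm_sq]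
  exact inner_div_self_le v

/-! ### Convection -/

section Convection

variable {a : EuclideanSpace ℝ (Fin d) → EuclideanSpace ℝ (Fin d)}

lemma memLp_top_of_eLpNorm_eq_one (hs : ContDiffOn ℝ ∞ a Ω.carrier)
    (hn : eLpNorm a ⊤ Ω.vol = 1) : MemLp a ⊤ Ω.vol :=
  ⟨hs.continuousOn.aestronglyMeasurable Ω.isOpen.measurableSet, by simp [hn]⟩

lemma memLp_apply (ha : MemLp a ⊤ Ω.vol) (l : Fin d) : MemLp (fun x => a x l) ⊤ Ω.vol :=
  ha.of_le ((EuclideanSpace.proj (𝕜 := ℝ) l).continuous.comp_aestronglyMeasurable ha.1)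
    (.of_forall fun x => PiLp.norm_apply_le (a x) l)

lemma eLpNorm_apply_le (l : Fin d) : eLpNorm (fun x => a x l) ⊤ Ω.vol ≤ eLpNorm a ⊤ Ω.vol :=
  eLpNorm_mono fun x => PiLp.norm_apply_le (a x) l

lemma convection_eq_sum (ha : MemLp a ⊤ Ω.vol) (u v : Ω.H10Vec) :
    convection a u v =
      ∑ c, ∑ l, inner ℝ (mulL (memLp_apply ha l) (partialDeriv u l c)) (comp v c) := by
  have hint : ∀ c l, Integrable
      (fun x => a x l * (partialDeriv u l c x * comp v c x)) Ω.vol := fun c l => by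
    refine (L2.integrable_inner (𝕜 := ℝ) (comp v c)
      (mulL (memLp_apply ha l) (partialDeriv u l c))).congr ?_
    filter_upwards [coeFn_mulL (memLp_apply ha l) (partialDeriv u l c)] with x hx
    simp [hx, mul_assoc]
  simp_rw [inner_mulL_eq_integral (memLp_apply ha _) (.refl _ _) (.refl _ _)]
  rw [convection, Finset.sum_congr rfl fun c _ =>
    (integral_finsetSum Finset.univ fun l _ => hint c l).symm,
    ← integral_finsetSum _ fun c _ => integrable_finsetSum _ fun l _ => hint c l]
  simp_rw [Finset.sum_mul, mul_assoc]

lemma abs_convection_le (i : Fin d) (ha : MemLp a ⊤ Ω.vol) (hn : eLpNorm a ⊤ Ω.vol ≤ 1)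
    (u v : Ω.H10Vec) :
    |convection a u v| ≤ d * (d * (Ω.friedrichs i * (gradNorm u * gradNorm v))) := by
  rw [convection_eq_sum ha]
  have hterm : ∀ c l, |inner ℝ (mulL (memLp_apply ha l) (partialDeriv u l c)) (comp v c)| ≤
      Ω.friedrichs i * (gradNorm u * gradNorm v) := fun c l => by
    calc _ ≤ ‖mulL (memLp_apply ha l) (partialDeriv u l c)‖ * ‖comp v c‖ :=
          abs_real_inner_le_norm _ _
      _ ≤ gradNorm u * (Ω.friedrichs i * gradNorm v) :=
          mul_le_mul ((norm_mulL_apply_le _ ((eLpNorm_apply_le l).trans hn) _).trans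
            (norm_partialDeriv_le u l c)) (norm_comp_le i v c) (norm_nonneg _) (gradNorm_nonneg u)
      _ = _ := by ring
  calc _ ≤ ∑ c : Fin d, ∑ l : Fin d, Ω.friedrichs i * (gradNorm u * gradNorm v) :=
        (Finset.abs_sum_le_sum_abs _ _).trans <| Finset.sum_le_sum fun c _ =>
          (Finset.abs_sum_le_sum_abs _ _).trans <| Finset.sum_le_sum fun l _ => hterm c l
    _ = _ := by simp

/-- On test functions the sum over `l` integrates by parts to `-∫ (div a) φχ = 0`. Since `a` is
bounded, both terms are continuous on `L² × (L²)^d`, so the identity passes to `H¹₀` without any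
control of the derivatives of `a` near the boundary. -/
lemma convection_skew (hs : ContDiffOn ℝ ∞ a Ω.carrier)
    (hdiv : ∀ x ∈ Ω.carrier, ∑ i, (fderiv ℝ a x (EuclideanSpace.single i 1)) i = 0)
    (ha : MemLp a ⊤ Ω.vol) (u v : Ω.H10Vec) : convection a u v = -convection a v u := by
  have key : ∀ f g : Ω.H10, ∑ l, (inner ℝ (mulL (memLp_apply ha l) (f.1.2 l)) g.1.1 +
      inner ℝ (mulL (memLp_apply ha l) f.1.1) (g.1.2 l)) = 0 := by
    intro f g
    have := bilin_eq_zero_of_testGraph (Ω := Ω)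
      (∑ l, (innerForm ((mulL (memLp_apply ha l)).comp (derivL l)) fnL +
        innerForm ((mulL (memLp_apply ha l)).comp fnL) (derivL l))) ?_ f g
    · simp only [sum_apply, add_apply] at this
      exact this
    rintro w ⟨φ, hφ, hφc, hφs, hw1, hw2⟩ w' ⟨χ, hχ, hχc, hχs, hw1', hw2'⟩
    simp only [sum_apply, add_apply]
    change ∑ l, (inner ℝ (mulL (memLp_apply ha l) (w.2 l)) w'.1 +
      inner ℝ (mulL (memLp_apply ha l) w.1) (w'.2 l)) = 0
    have hal : ∀ l, ContDiffOn ℝ 1 (fun x => a x l) Ω.carrier := fun l =>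
      (EuclideanSpace.proj (𝕜 := ℝ) l).contDiff.comp_contDiffOn (hs.of_le (by simp))
    have hs' : tsupport (fun x => φ x * χ x) ⊆ Ω.carrier := tsupport_mul_subset_left.trans hφs
    have hterm : ∀ l, inner ℝ (mulL (memLp_apply ha l) (w.2 l)) w'.1 +
        inner ℝ (mulL (memLp_apply ha l) w.1) (w'.2 l) =
        -∫ x, fderiv ℝ (fun y => a y l) x (EuclideanSpace.single l 1) * (φ x * χ x) ∂Ω.vol :=
      fun l => by
        rw [inner_mulL_eq_integral _ (hw2 l) hw1', inner_mulL_eq_integral _ hw1 (hw2' l),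
          integral_mul_fderiv_mul_add (hal l) hφ hφc hφs hχ]
    rw [Finset.sum_congr rfl fun l _ => hterm l, Finset.sum_neg_distrib, ← integral_finsetSum]
    · rw [neg_eq_zero]
      refine (setIntegral_congr_fun Ω.isOpen.measurableSet fun x hx => ?_).trans
        (integral_zero _ _)
      have hda : DifferentiableAt ℝ a x :=
        (hs.differentiableOn (by simp)).differentiableAt (Ω.isOpen.mem_nhds hx)
      have hc : ∀ l v, fderiv ℝ (fun y => a y l) x v = fderiv ℝ a x v l := fun l v => by
        have := ((EuclideanSpace.proj (𝕜 := ℝ) l).hasFDerivAt.comp x hda.hasFDerivAt).fderiv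
        exact congrArg (fun T => T v) this
      simp only [hc, ← Finset.sum_mul, hdiv x hx, zero_mul]
    · intro l _
      exact (integrable_mul_of_tsupport_subset
        (((hal l).continuousOn_fderiv_of_isOpen Ω.isOpen le_rfl).clm_apply continuousOn_const)
        (hφ.continuous.mul hχ.continuous) hφc.mul_right hs').integrableOn
  have hmul : ∀ l (p q : Ω.L2), inner ℝ (mulL (memLp_apply ha l) p) q =
      inner ℝ (mulL (memLp_apply ha l) q) p := fun l p q => by
    rw [inner_mulL_eq_integral _ (.refl _ p) (.refl _ q),
      inner_mulL_eq_integral _ (.refl _ q) (.refl _ p)]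
    simp_rw [mul_comm (p _)]
  rw [convection_eq_sum ha, convection_eq_sum ha, ← Finset.sum_neg_distrib]
  refine Finset.sum_congr rfl fun c _ => ?_
  have := key (u c) (v c)
  rw [Finset.sum_add_distrib] at this
  rw [eq_neg_iff_add_eq_zero, ← this]
  congr 1
  exact Finset.sum_congr rfl fun l _ => hmul _ _ _

end Convection

end PolyhedralDomain

/-! ### From coefficient vectors to bilinear forms on functions. -/

lemma dotProduct_mulVec_of_bilin {V W ι κ : Type*} [AddCommGroup V] [Module ℝ V] [AddCommGroup W]
    [Module ℝ W] [Fintype ι] [Fintype κ] (β : V →ₗ[ℝ] W →ₗ[ℝ] ℝ) (p : ι → V) (q : κ → W)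
    (y : ι → ℝ) (x : κ → ℝ) :
    y ⬝ᵥ (Matrix.of fun i j => β (p i) (q j)) *ᵥ x = β (∑ i, y i • p i) (∑ j, x j • q j) := by
  simp only [dotProduct, Matrix.mulVec, Matrix.of_apply, map_sum, map_smul, LinearMap.sum_apply,
    LinearMap.smul_apply, smul_eq_mul, Finset.mul_sum]
  rw [Finset.sum_comm]
  exact Finset.sum_congr rfl fun _ _ => Finset.sum_congr rfl fun _ _ => by ring

namespace PolyhedralDomain

variable {d : ℕ} {Ω : PolyhedralDomain d}

lemma partialDeriv_add (u v : Ω.H10Vec) (l c : Fin d) :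
    partialDeriv (u + v) l c = partialDeriv u l c + partialDeriv v l c := rfl

lemma partialDeriv_smul (r : ℝ) (v : Ω.H10Vec) (l c : Fin d) :
    partialDeriv (r • v) l c = r • partialDeriv v l c := rfl

lemma comp_add (u v : Ω.H10Vec) (c : Fin d) : comp (u + v) c = comp u c + comp v c := rfl

lemma comp_smul (r : ℝ) (v : Ω.H10Vec) (c : Fin d) : comp (r • v) c = r • comp v c := rfl

lemma div_add (u v : Ω.H10Vec) : div (u + v) = div u + div v := by
  simp [div, partialDeriv_add, Finset.sum_add_distrib]

lemma div_smul (r : ℝ) (v : Ω.H10Vec) : div (r • v) = r • div v := by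
  simp [div, partialDeriv_smul, Finset.smul_sum]

/-- `(∇u, ∇v)` as a bilinear form. -/
noncomputable def gradBilin (Ω : PolyhedralDomain d) : LinearMap.BilinForm ℝ Ω.H10Vec :=
  LinearMap.mk₂ ℝ gradInner
    (by simp [gradInner, partialDeriv_add, inner_add_left, Finset.sum_add_distrib])
    (by simp [gradInner, partialDeriv_smul, real_inner_smul_left, Finset.mul_sum])
    (by simp [gradInner, partialDeriv_add, inner_add_right, Finset.sum_add_distrib])
    (by simp [gradInner, partialDeriv_smul, real_inner_smul_right, Finset.mul_sum])

/-- `(div u, div v)` as a bilinear form. -/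
noncomputable def divBilin (Ω : PolyhedralDomain d) : LinearMap.BilinForm ℝ Ω.H10Vec :=
  LinearMap.mk₂ ℝ (fun u v => inner ℝ (div u) (div v))
    (by simp [div_add, inner_add_left]) (by simp [div_smul, real_inner_smul_left])
    (by simp [div_add, inner_add_right]) (by simp [div_smul, real_inner_smul_right])

/-- `(q, v) ↦ -(q, div v)` as a bilinear map. -/
noncomputable def bBilin (Ω : PolyhedralDomain d) : Ω.L2 →ₗ[ℝ] Ω.H10Vec →ₗ[ℝ] ℝ :=
  LinearMap.mk₂ ℝ (fun q v => bForm v q)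
    (by simp [bForm, inner_add_left, add_comm]) (by simp [bForm, real_inner_smul_left])
    (by simp [bForm, div_add, inner_add_right, add_comm])
    (by simp [bForm, div_smul, real_inner_smul_right])

/-- `(v, u) ↦ (a · ∇u, v)` as a bilinear form. -/
noncomputable def convectionBilin {a : EuclideanSpace ℝ (Fin d) → EuclideanSpace ℝ (Fin d)}
    (ha : MemLp a ⊤ Ω.vol) : LinearMap.BilinForm ℝ Ω.H10Vec :=
  LinearMap.mk₂ ℝ (fun v u => convection a u v)
    (by simp [convection_eq_sum ha, comp_add, inner_add_right, Finset.sum_add_distrib])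
    (by simp [convection_eq_sum ha, comp_smul, real_inner_smul_right, Finset.mul_sum])
    (by simp [convection_eq_sum ha, partialDeriv_add, inner_add_left, Finset.sum_add_distrib])
    (by simp [convection_eq_sum ha, partialDeriv_smul, real_inner_smul_left, Finset.mul_sum])

end PolyhedralDomain

/-! ### Structural properties and stability of the Oseen matrices. -/

namespace OseenDiscretization

open PolyhedralDomain

variable {d : ℕ} {Ω : PolyhedralDomain d} (D : OseenDiscretization Ω)

/-- The discrete velocity with coefficient vector `x`. -/
noncomputable def velocity (x : Fin D.n → ℝ) : Ω.H10Vec := ∑ j, x j • (D.ψ j : Ω.H10Vec)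

/-- The discrete pressure with coefficient vector `y`. -/
noncomputable def pressure (y : Fin D.m → ℝ) : Ω.L2 := ∑ i, y i • (D.φ i : Ω.L2)

lemma coe_equivFun_symm_ψ (x : Fin D.n → ℝ) :
    ((D.ψ.equivFun.symm x : D.mesh.velocitySpace D.k) : Ω.H10Vec) = D.velocity x := by
  simp [velocity, Module.Basis.equivFun_symm_apply]

lemma coe_equivFun_symm_φ (y : Fin D.m → ℝ) :
    ((D.φ.equivFun.symm y : D.mesh.pressureSpace D.k) : Ω.L2) = D.pressure y := by
  simp [pressure, Module.Basis.equivFun_symm_apply]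

lemma velocity_ne_zero {x : Fin D.n → ℝ} (hx : x ≠ 0) : D.velocity x ≠ 0 := by
  rw [← coe_equivFun_symm_ψ, Ne, Submodule.coe_eq_zero, LinearEquiv.map_eq_zero_iff]
  exact hx

lemma pressure_ne_zero {y : Fin D.m → ℝ} (hy : y ≠ 0) : D.pressure y ≠ 0 := by
  rw [← coe_equivFun_symm_φ, Ne, Submodule.coe_eq_zero, LinearEquiv.map_eq_zero_iff]
  exact hy

lemma pressure_mem (y : Fin D.m → ℝ) : D.pressure y ∈ D.mesh.pressureSpace D.k := by
  rw [← coe_equivFun_symm_φ]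
  exact Submodule.coe_mem _

lemma velocity_equivFun (v : D.mesh.velocitySpace D.k) :
    D.velocity (D.ψ.equivFun v) = (v : Ω.H10Vec) := by
  rw [← coe_equivFun_symm_ψ, LinearEquiv.symm_apply_apply]

lemma memLp_a : MemLp D.a ⊤ Ω.vol := memLp_top_of_eLpNorm_eq_one D.a_smooth D.a_norm

lemma ν_add_γ_pos : 0 < D.ν + D.γ := add_pos_of_pos_of_nonneg D.ν_pos D.γ_nonneg

lemma dotProduct_matA_mulVec (y x : Fin D.n → ℝ) :
    y ⬝ᵥ D.matA *ᵥ x = D.ν * gradInner (D.velocity y) (D.velocity x) +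
      convection D.a (D.velocity x) (D.velocity y) +
      D.γ * inner ℝ (div (D.velocity y)) (div (D.velocity x)) := by
  have h1 : y ⬝ᵥ D.matD *ᵥ x = gradInner (D.velocity y) (D.velocity x) :=
    dotProduct_mulVec_of_bilin (gradBilin Ω) _ _ y x
  have h2 : y ⬝ᵥ D.matN *ᵥ x = convection D.a (D.velocity x) (D.velocity y) :=
    dotProduct_mulVec_of_bilin (convectionBilin D.memLp_a) _ _ y x
  have h3 : y ⬝ᵥ D.matG *ᵥ x = inner ℝ (div (D.velocity y)) (div (D.velocity x)) :=
    dotProduct_mulVec_of_bilin (divBilin Ω) _ _ y x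
  simp only [matA, Matrix.add_mulVec, Matrix.smul_mulVec, dotProduct_add, dotProduct_smul,
    smul_eq_mul, h1, h2, h3]

lemma dotProduct_matB_mulVec (y : Fin D.m → ℝ) (x : Fin D.n → ℝ) :
    y ⬝ᵥ D.matB *ᵥ x = bForm (D.velocity x) (D.pressure y) :=
  dotProduct_mulVec_of_bilin (bBilin Ω) _ _ y x

lemma dotProduct_matC_mulVec (y : Fin D.m → ℝ) :
    y ⬝ᵥ D.matC *ᵥ y = (D.ν + D.γ)⁻¹ * D.s (D.pressure y) (D.pressure y) :=
  dotProduct_mulVec_of_bilin ((D.ν + D.γ)⁻¹ • D.s) _ _ y y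

lemma dotProduct_smul_matM_mulVec (y : Fin D.m → ℝ) :
    y ⬝ᵥ ((D.ν + D.γ)⁻¹ • D.matM) *ᵥ y = (D.ν + D.γ)⁻¹ * ‖D.pressure y‖ ^ 2 := by
  have h : y ⬝ᵥ D.matM *ᵥ y = inner ℝ (D.pressure y) (D.pressure y) :=
    dotProduct_mulVec_of_bilin (innerₗ Ω.L2) _ _ y y
  rw [Matrix.smul_mulVec, dotProduct_smul, smul_eq_mul, h, real_inner_self_eq_norm_sq]

lemma dotProduct_matA_mulVec_self (x : Fin D.n → ℝ) :
    x ⬝ᵥ D.matA *ᵥ x = D.ν * gradNorm (D.velocity x) ^ 2 + D.γ * ‖div (D.velocity x)‖ ^ 2 := by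
  have := convection_skew D.a_smooth D.a_divfree D.memLp_a (D.velocity x) (D.velocity x)
  rw [dotProduct_matA_mulVec, real_inner_self_eq_norm_sq, gradNorm_sq]
  linarith

lemma dotProduct_matAs_mulVec_self (x : Fin D.n → ℝ) :
    x ⬝ᵥ D.matAs *ᵥ x = x ⬝ᵥ D.matA *ᵥ x := by
  have h : x ⬝ᵥ D.matAᵀ *ᵥ x = x ⬝ᵥ D.matA *ᵥ x := by
    rw [Matrix.mulVec_transpose, Matrix.dotProduct_mulVec, dotProduct_comm]
  rw [matAs, Matrix.smul_mulVec, Matrix.add_mulVec, dotProduct_smul, dotProduct_add, h, smul_eq_mul]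
  ring

lemma saddlePoint (i : Fin d) :
    SaddlePoint D.matA D.matAs D.matB D.matC ((D.ν + D.γ)⁻¹ • D.matM) where
  symmPart x := (D.dotProduct_matAs_mulVec_self x).symm
  posDef_As := by
    refine Matrix.PosDef.of_dotProduct_mulVec_pos ?_ fun x hx => ?_
    · rw [Matrix.IsHermitian, Matrix.conjTranspose_eq_transpose_of_trivial, matAs,
        Matrix.transpose_smul, Matrix.transpose_add, Matrix.transpose_transpose, add_comm]
    · rw [star_trivial, dotProduct_matAs_mulVec_self, dotProduct_matA_mulVec_self]
      have h1 : 0 < gradNorm (D.velocity x) ^ 2 := by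
        rw [gradNorm_sq]
        refine (gradInner_self_nonneg _).lt_of_ne fun h => ?_
        exact D.velocity_ne_zero hx (eq_zero_of_gradInner_eq_zero i h.symm)
      have := mul_pos D.ν_pos h1
      have := mul_nonneg D.γ_nonneg (sq_nonneg ‖div (D.velocity x)‖)
      linarith
  posDef_Q := by
    refine Matrix.PosDef.of_dotProduct_mulVec_pos ?_ fun y hy => ?_
    · ext i j
      simp [matM, real_inner_comm]
    · rw [star_trivial, dotProduct_smul_matM_mulVec]
      have := norm_pos_iff.2 (D.pressure_ne_zero hy)
      have := D.ν_add_γ_pos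
      positivity
  posSemidef_C := by
    refine Matrix.PosSemidef.of_dotProduct_mulVec_nonneg ?_ fun y => ?_
    · ext i j
      simp [matC, D.s_symm (D.φ i)]
    · rw [star_trivial, dotProduct_matC_mulVec]
      exact mul_nonneg (inv_nonneg.2 D.ν_add_γ_pos.le) (D.s_nonneg _)
  -- The weight `ν + γ` splits `2‖p‖‖div v‖`; then `ν‖div v‖² ≤ ν‖∇v‖²`, so the constant one in
  -- `norm_div_le` is what makes this exact scaling of the mass matrix work.
  young q x := by
    rw [dotProduct_matB_mulVec, dotProduct_smul_matM_mulVec, dotProduct_matAs_mulVec_self,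
      dotProduct_matA_mulVec_self, bForm]
    set p := D.pressure q
    set v := D.velocity x
    have ht := D.ν_add_γ_pos
    have h1 := (abs_le.1 (abs_real_inner_le_norm p (div v))).1
    have h2 : ‖div v‖ ^ 2 ≤ gradNorm v ^ 2 :=
      pow_le_pow_left₀ (norm_nonneg _) (norm_div_le v) 2
    have h3 := mul_le_mul_of_nonneg_left h2 D.ν_pos.le
    have h4 : 2 * (‖p‖ * ‖div v‖) ≤ (D.ν + D.γ)⁻¹ * ‖p‖ ^ 2 + (D.ν + D.γ) * ‖div v‖ ^ 2 := by
      have h5 := mul_nonneg (inv_nonneg.2 ht.le) (sq_nonneg (‖p‖ - (D.ν + D.γ) * ‖div v‖))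
      have h6 : (D.ν + D.γ)⁻¹ * (‖p‖ - (D.ν + D.γ) * ‖div v‖) ^ 2 =
          (D.ν + D.γ)⁻¹ * ‖p‖ ^ 2 + (D.ν + D.γ) * ‖div v‖ ^ 2 - 2 * (‖p‖ * ‖div v‖) := by
        field_simp
        ring
      linarith
    linarith

/-- The inf-sup condition bounds the pressure by the velocity that it generates. -/
lemma InfSup.mul_norm_pressure_le {δ₀ : ℝ} (h : D.InfSup δ₀) (i : Fin d) {w : Fin D.m → ℝ}
    {u : Fin D.n → ℝ} (hu : D.matAᵀ *ᵥ u = D.matBᵀ *ᵥ w) :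
    δ₀ * ‖D.pressure w‖ ≤
      (D.ν + d * (d * Ω.friedrichs i) + D.γ) * gradNorm (D.velocity u) +
        Real.sqrt (D.s (D.pressure w) (D.pressure w)) := by
  refine (h _ (D.pressure_mem w)).trans (add_le_add_left ?_ _)
  have hF : 0 ≤ Ω.friedrichs i := by unfold friedrichs; positivity
  have hK : 0 ≤ D.ν + d * (d * Ω.friedrichs i) + D.γ := by
    have := D.ν_pos
    have := D.γ_nonneg
    positivity
  -- The bound must be nonnegative because the supremum over an empty set, when `V_h = {0}`, is `0`.
  refine Real.iSup_le (fun v => ?_) (mul_nonneg hK (gradNorm_nonneg _))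
  refine div_le_of_le_mul₀ (gradNorm_nonneg _) (mul_nonneg hK (gradNorm_nonneg _)) ?_
  set x := D.ψ.equivFun v.1
  have hx : D.velocity x = (v.1 : Ω.H10Vec) := D.velocity_equivFun v.1
  rw [← hx]
  -- The equation `Aᵀu = Bᵀw` replaces the pressure functional by the form of `A_γ` with `u` in the
  -- test slot, which is continuous in `‖∇·‖`.
  have hb : bForm (D.velocity x) (D.pressure w) = u ⬝ᵥ D.matA *ᵥ x := by
    rw [← dotProduct_matB_mulVec, Matrix.dotProduct_mulVec, ← Matrix.mulVec_transpose, ← hu,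
      Matrix.mulVec_transpose, ← Matrix.dotProduct_mulVec]
  rw [hb, dotProduct_matA_mulVec]
  set V := D.velocity x
  set U := D.velocity u
  have h1 := mul_le_mul_of_nonneg_left ((le_abs_self _).trans (abs_gradInner_le U V)) D.ν_pos.le
  have h2 := (le_abs_self _).trans (abs_convection_le i D.memLp_a D.a_norm.le V U)
  have h3 : inner ℝ (div U) (div V) ≤ gradNorm U * gradNorm V :=
    (real_inner_le_norm _ _).trans
      (mul_le_mul (norm_div_le U) (norm_div_le V) (norm_nonneg _) (gradNorm_nonneg _))
  have h4 := mul_le_mul_of_nonneg_left h3 D.γ_nonneg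
  nlinarith

/-- Squaring the inf-sup estimate gives `δ₀²‖p‖² ≤ 2K²‖∇u‖² + 2s(p, p)`. The velocity term is
weighted by `ν` in `u·A_s u`, and `Ŝ` carries `(ν + γ)⁻¹`; this is where the factor `ν(ν + γ)` comes
from. `hc1` absorbs the velocity term, `hc2` the stabilization terms. -/
lemma InfSup.schur_bound {δ₀ : ℝ} (hδ₀ : 0 < δ₀) (h : D.InfSup δ₀) (i : Fin d) {R c : ℝ}
    (hν : D.ν ≤ R) (hγ : D.γ ≤ R) (hc : 0 < c)
    (hc1 : 4 * (R + d * (d * Ω.friedrichs i) + R) ^ 2 * c ≤ δ₀ ^ 2)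
    (hc2 : 2 * R ^ 2 * (2 + δ₀ ^ 2) * c ≤ δ₀ ^ 2) (w : Fin D.m → ℝ) (u : Fin D.n → ℝ)
    (hu : D.matAᵀ *ᵥ u = D.matBᵀ *ᵥ w) :
    c * (D.ν * (D.ν + D.γ)) * (w ⬝ᵥ ((D.ν + D.γ)⁻¹ • D.matM + D.matC) *ᵥ w) ≤
      1 / 2 * (u ⬝ᵥ D.matAs *ᵥ u) + w ⬝ᵥ D.matC *ᵥ w := by
  rw [Matrix.add_mulVec, dotProduct_add, dotProduct_smul_matM_mulVec, dotProduct_matC_mulVec,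
    dotProduct_matAs_mulVec_self, dotProduct_matA_mulVec_self]
  have h1 := h.mul_norm_pressure_le D i hu
  have hν0 := D.ν_pos
  have hγ0 := D.γ_nonneg
  have ht := D.ν_add_γ_pos
  have hσ := D.s_nonneg (D.pressure w)
  have hF : 0 ≤ Ω.friedrichs i := by unfold friedrichs; positivity
  set g := gradNorm (D.velocity u)
  have hg : 0 ≤ g := gradNorm_nonneg _
  set σ := D.s (D.pressure w) (D.pressure w)
  set P := ‖D.pressure w‖
  have hP : 0 ≤ P := norm_nonneg _
  set K := R + d * (d * Ω.friedrichs i) + R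
  have h2 : δ₀ * P ≤ K * g + Real.sqrt σ := by
    refine h1.trans (add_le_add_left (mul_le_mul_of_nonneg_right ?_ hg) _)
    exact add_le_add (add_le_add_left hν _) hγ
  have h3 : δ₀ ^ 2 * P ^ 2 ≤ 2 * (K ^ 2 * g ^ 2) + 2 * σ := by
    have h4 := pow_le_pow_left₀ (mul_nonneg hδ₀.le hP) h2 2
    have h5 := Real.sq_sqrt hσ
    nlinarith [sq_nonneg (K * g - Real.sqrt σ)]
  have hδ2 : 0 < δ₀ ^ 2 := by positivity
  have h6 : D.ν * (D.ν + D.γ) ≤ 2 * R ^ 2 := by nlinarith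
  -- the inequality multiplied by `δ₀²`
  have h7 : δ₀ ^ 2 * (c * D.ν * P ^ 2) ≤ 1 / 2 * D.ν * g ^ 2 * δ₀ ^ 2 + 2 * c * D.ν * σ := by
    have h8 := mul_le_mul_of_nonneg_left h3 (mul_pos hc hν0).le
    have h9 := mul_le_mul_of_nonneg_right hc1 (mul_nonneg hν0.le (sq_nonneg g))
    nlinarith
  -- The `2` comes from the squared inf-sup estimate, the `δ₀²` from the `C` part of `Ŝ`.
  have h10 : c * D.ν * (2 + δ₀ ^ 2) * σ ≤ δ₀ ^ 2 * ((D.ν + D.γ)⁻¹ * σ) := by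
    rw [← mul_assoc]
    refine mul_le_mul_of_nonneg_right ?_ hσ
    rw [← div_eq_mul_inv, le_div_iff₀ ht]
    have := mul_le_mul_of_nonneg_left h6 (mul_pos hc (by positivity : 0 < 2 + δ₀ ^ 2)).le
    linarith
  have h11 : c * (D.ν * (D.ν + D.γ)) * ((D.ν + D.γ)⁻¹ * P ^ 2 + (D.ν + D.γ)⁻¹ * σ) =
      c * D.ν * P ^ 2 + c * D.ν * σ := by
    field_simp
  rw [h11]
  have h12 := mul_nonneg hγ0 (sq_nonneg ‖div (D.velocity u)‖)
  refine le_of_mul_le_mul_left ?_ hδ2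
  have h13 := mul_nonneg hδ2.le h12
  linarith

end OseenDiscretization

/-! ### Choice of constants and conclusion. -/

theorem theorem4p2 {d : ℕ} (hd : d = 2 ∨ d = 3) (Ω : PolyhedralDomain d)
    (δ₀ : ℝ) (hδ₀ : 0 < δ₀) (R : ℝ) :
    ∃ c > (0 : ℝ), ∃ ct > (0 : ℝ), ∀ D : OseenDiscretization Ω,
      D.InfSup δ₀ → D.ν ≤ R → D.γ ≤ R →
      -- the matrices and the inner product are well defined
      (D.matCalM.PosDef ∧ IsUnit D.matA.det ∧ IsUnit D.matS.det ∧ IsUnit D.matK.det ∧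
        IsUnit D.matP.det) ∧
      -- field-of-values bound for `𝒦 𝒫̂⁻¹`
      (D.μ (D.matK * D.matP⁻¹) =
          D.μ (.fromBlocks 1 0 (D.matB * D.matA⁻¹) (D.matS * D.matShat⁻¹)) ∧
        ((c * (D.ν * (D.ν + D.γ)) : ℝ) : EReal) ≤ D.μ (D.matK * D.matP⁻¹)) ∧
      -- field-of-values bound for `𝒫̂ 𝒦⁻¹`
      (D.μ (D.matP * D.matK⁻¹) =
          D.μ (.fromBlocks 1 0 (-(D.matShat * D.matS⁻¹ * D.matB * D.matA⁻¹))
            (D.matShat * D.matS⁻¹)) ∧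
        ((1 / 2 : ℝ) : EReal) ≤ D.μ (D.matP * D.matK⁻¹)) ∧
      -- convergence of preconditioned GMRES in the `ℳ⁻¹` norm
      (ct * (D.ν * (D.ν + D.γ)) ≤ 1 ∧
        ∀ (b x₀ x : Fin D.n ⊕ Fin D.m → ℝ) (k : ℕ),
          IsGMRESIterate D.matCalM⁻¹ D.matK D.matP b x₀ k x →
          wNorm D.matCalM⁻¹ (b - D.matK *ᵥ x) ≤
            (1 - ct * (D.ν * (D.ν + D.γ))) ^ ((k : ℝ) / 2) *
              wNorm D.matCalM⁻¹ (b - D.matK *ᵥ x₀)) := by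
  -- Any direction will do; it only selects a Friedrichs constant, which depends on the domain
  -- alone.
  have i : Fin d := ⟨0, by omega⟩
  -- The first two conditions feed `InfSup.schur_bound`. The third forces `c ν(ν + γ) ≤ 1/2`, needed
  -- for the `x` block of the first field-of-values bound.
  obtain ⟨c, hc, hc1, hc2, hc3⟩ : ∃ c > (0 : ℝ),
      4 * (R + d * (d * Ω.friedrichs i) + R) ^ 2 * c ≤ δ₀ ^ 2 ∧
      2 * R ^ 2 * (2 + δ₀ ^ 2) * c ≤ δ₀ ^ 2 ∧ 4 * R ^ 2 * c ≤ 1 := by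
    set K := R + d * (d * Ω.friedrichs i) + R
    have hden : 0 < 4 * K ^ 2 + 4 * R ^ 2 * (2 + δ₀ ^ 2) + 1 := by positivity
    have hK := sq_nonneg K
    have hR := sq_nonneg R
    have hRδ := mul_nonneg hR (sq_nonneg δ₀)
    refine ⟨δ₀ ^ 2 / (4 * K ^ 2 + 4 * R ^ 2 * (2 + δ₀ ^ 2) + 1), by positivity, ?_, ?_, ?_⟩
    · rw [mul_div_assoc', div_le_iff₀ hden, mul_comm]
      exact mul_le_mul_of_nonneg_left (by linarith) (sq_nonneg _)
    · rw [mul_div_assoc', div_le_iff₀ hden, mul_comm]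
      exact mul_le_mul_of_nonneg_left (by linarith) (sq_nonneg _)
    · rw [mul_div_assoc', div_le_iff₀ hden]
      linarith
  -- The GMRES rate is `αβ` with `α = c ν(ν + γ)` and `β = 1/2`.
  refine ⟨c, hc, c / 2, by positivity, fun D hD hν hγ => ?_⟩
  have hν0 := D.ν_pos
  have hγ0 := D.γ_nonneg
  have hε0 : 0 < c * (D.ν * (D.ν + D.γ)) := mul_pos hc (mul_pos hν0 D.ν_add_γ_pos)
  have hε : c * (D.ν * (D.ν + D.γ)) ≤ 1 / 2 := by
    have h6 : D.ν * (D.ν + D.γ) ≤ 2 * R ^ 2 := by nlinarith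
    have := mul_le_mul_of_nonneg_left h6 hc.le
    linarith
  have hD' := D.saddlePoint i
  have hinf := hD.schur_bound D hδ₀ i hν hγ hc hc1 hc2
  have hS : IsUnit D.matS.det := hD'.isUnit_det_schur hε0 hinf
  have hK : IsUnit D.matK.det := hD'.isUnit_det_system hS
  have hP : IsUnit D.matP.det := hD'.isUnit_det_preconditioner
  have hM : D.matCalM.PosDef := hD'.posDef_As.fromBlocks_diagonal hD'.posDef_add
  have hKP : D.matK * D.matP⁻¹ =
      .fromBlocks 1 0 (D.matB * D.matA⁻¹) (D.matS * D.matShat⁻¹) :=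
    hD'.system_mul_inv_preconditioner
  have hPK : D.matP * D.matK⁻¹ = .fromBlocks 1 0 (-(D.matShat * D.matS⁻¹ * D.matB * D.matA⁻¹))
      (D.matShat * D.matS⁻¹) := hD'.preconditioner_mul_inv_system hS
  have h1 : ∀ z, c * (D.ν * (D.ν + D.γ)) * wInner D.matCalM⁻¹ z z ≤
      wInner D.matCalM⁻¹ ((D.matK * D.matP⁻¹) *ᵥ z) z := by
    rw [hKP]
    exact hD'.wInner_system_mul_inv_preconditioner hε hinf
  have h2 : ∀ z, 1 / 2 * wInner D.matCalM⁻¹ z z ≤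
      wInner D.matCalM⁻¹ ((D.matP * D.matK⁻¹) *ᵥ z) z := by
    rw [hPK]
    exact hD'.wInner_preconditioner_mul_inv_system hS
  have hct : c / 2 * (D.ν * (D.ν + D.γ)) = c * (D.ν * (D.ν + D.γ)) * (1 / 2) := by ring
  refine ⟨⟨hM, hD'.isUnit_det, hS, hK, hP⟩, ⟨by rw [hKP], le_fovLower hM.inv h1⟩,
    ⟨by rw [hPK], le_fovLower hM.inv h2⟩, by rw [hct]; linarith, fun b x₀ x k hx => ?_⟩
  rw [hct]
  refine hx.wNorm_residual_le hM.inv (by norm_num) (by linarith) h1 fun z => ?_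
  -- At `𝒦𝒫̂⁻¹z` the inverse `𝒫̂𝒦⁻¹` returns `z`, so the second bound becomes `½‖Xz‖² ≤ ⟨Xz, z⟩` for
  -- `X = 𝒦𝒫̂⁻¹`.
  have h3 := h2 ((D.matK * D.matP⁻¹) *ᵥ z)
  rwa [Matrix.mulVec_mulVec, Matrix.mul_assoc, Matrix.nonsing_inv_mul_cancel_left _ _ hK,
    Matrix.mul_nonsing_inv _ hP, Matrix.one_mulVec, wInner_comm hM.inv.isSymm z] at h3
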